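/- Let $X$ be a complex Banach space. An operator $S(X\to X)$ is a linear map from a linear subspace $\mathcal D(S)\subset X$ into $X$; $\mathcal D(S^2)=\{x\in\mathcal D(S): Sx\in\mathcal D(S)\}$; its resolvent set $\varrho(S)$ consists of all $\lambda\in\mathbb C$ for which $S-\lambda:\mathcal D(S)\to X$ is bijective with bounded inverse, and $\sigma(S)=\mathbb C\setminus\varrho(S)$. A subspace $M\subset X$ is $S$-invariant if $S(\mathcal D(S)\cap M)\subset M$; then $S|M$ denotes the restriction of $S$, regarded as an operator in $M$ with domain $\mathcal D(S)\cap M$. The operator $S$ is called strictly dichotomous if there are closed subspaces $X_+,X_-$ with $X=X_+\oplus X_-$ such that (a) $\mathrm i\mathbb R\subset\varrho(S)$; (b) $X_+$ and $X_-$ are $S$-invariant; (c) $\sigma(S|X_+)\subset\{\operatorname{Re}\lambda>0\}$ and $\sigma(S|X_-)\subset\{\operatorname{Re}\lambda<0\}$; (d) $\|(S|X_+-\lambda)^{-1}\|$ is bounded on $\{\operatorname{Re}\lambda\le 0\}$ and $\|(S|X_--\lambda)^{-1}\|$ is bounded on $\{\operatorname{Re}\lambda\ge 0\}$. Theorem.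 Let $S(X\to X)$ be a densely defined and strictly dichotomous operator on the complex Banach space $X$. Suppose that $T(X\to X)$ is a densely defined operator and that there exist $h>0$ and $\varepsilon>0$ such that 1. $\{\lambda\in\mathbb C: |\operatorname{Re}\lambda|\le h\}\subset\varrho(S)\cap\varrho(T)$; 2. $\sup_{|\operatorname{Re}\lambda|\le h}|\lambda|^{1+\varepsilon}\,\|(S-\lambda)^{-1}-(T-\lambda)^{-1}\|<\infty$; 3. $\mathcal D(S^2)\cap\mathcal D(T^2)$ is dense in $X$. Then $T$ is strictly dichotomous. -/

import Mathlib

namespace LinearPMap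

variable {X : Type*} [NormedAddCommGroup X] [NormedSpace ℂ X]

/-- `R` is the everywhere defined bounded two-sided inverse of `S - z : D(S) → X`. -/
def IsResolventAt (S : X →ₗ.[ℂ] X) (z : ℂ) (R : X →L[ℂ] X) : Prop :=
  (∀ y : X, ∃ hy : R y ∈ S.domain, S ⟨R y, hy⟩ - z • R y = y) ∧
    ∀ x : S.domain, R (S x - z • (x : X)) = x

/-- The resolvent set: all `z` such that `S - z : D(S) → X` is bijective with bounded inverse. -/
def resolventSet (S : X →ₗ.[ℂ] X) : Set ℂ :=
  {z | ∃ R : X →L[ℂ] X, S.IsResolventAt z R}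

/-- The spectrum, i.e. the complement of the resolvent set. -/
def spectrumSet (S : X →ₗ.[ℂ] X) : Set ℂ :=
  S.resolventSetᶜ

open Classical in
/-- The resolvent `(S - z)⁻¹` as a bounded operator (`0` if `z` is not in the resolvent set). -/
noncomputable def resolventOp (S : X →ₗ.[ℂ] X) (z : ℂ) : X →L[ℂ] X :=
  if h : ∃ R : X →L[ℂ] X, S.IsResolventAt z R then h.choose else 0

/-- `D(S²)`: all `x ∈ D(S)` with `S x ∈ D(S)`. -/
def domainSq (S : X →ₗ.[ℂ] X) : Set X :=
  {x | ∃ hx : x ∈ S.domain, S ⟨x, hx⟩ ∈ S.domain}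

/-- `M` is `S`-invariant: `S` maps `D(S) ∩ M` into `M`. -/
def IsInvariant (S : X →ₗ.[ℂ] X) (M : Submodule ℂ X) : Prop :=
  ∀ x : S.domain, (x : X) ∈ M → S x ∈ M

/-- The restriction `S|M` to an `S`-invariant subspace `M`, as an operator in `M` with
domain `D(S) ∩ M`. -/
def restrictTo (S : X →ₗ.[ℂ] X) (M : Submodule ℂ X) (hM : S.IsInvariant M) : M →ₗ.[ℂ] M where
  domain := S.domain.comap M.subtype
  toFun :=
    { toFun := fun x => ⟨S ⟨((x : M) : X), x.2⟩, hM ⟨((x : M) : X), x.2⟩ (x : M).2⟩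
      map_add' := fun x y =>
        Subtype.ext (S.map_add ⟨((x : M) : X), x.2⟩ ⟨((y : M) : X), y.2⟩)
      map_smul' := fun c x => Subtype.ext (S.map_smul c ⟨((x : M) : X), x.2⟩) }

/-- `S` is dichotomous with respect to the decomposition `X = Xp ⊕ Xm` into closed subspaces. -/
structure IsDichotomousWrt (S : X →ₗ.[ℂ] X) (Xp Xm : Submodule ℂ X) : Prop where
  isClosed_plus : _root_.IsClosed (Xp : Set X)
  isClosed_minus : _root_.IsClosed (Xm : Set X)
  isCompl : IsCompl Xp Xm
  imaginary_axis : ∀ z : ℂ, z.re = 0 → z ∈ S.resolventSet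
  invariant_plus : S.IsInvariant Xp
  invariant_minus : S.IsInvariant Xm
  spectrum_plus : (S.restrictTo Xp invariant_plus).spectrumSet ⊆ {z : ℂ | 0 < z.re}
  spectrum_minus : (S.restrictTo Xm invariant_minus).spectrumSet ⊆ {z : ℂ | z.re < 0}

/-- `S` is strictly dichotomous with respect to `X = Xp ⊕ Xm`: in addition, the resolvents of the
restrictions to `Xp` and `Xm` are bounded on the closed left and right half-plane, respectively. -/
structure IsStrictlyDichotomousWrt (S : X →ₗ.[ℂ] X) (Xp Xm : Submodule ℂ X) : Prop
    extends S.IsDichotomousWrt Xp Xm where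
  bounded_plus :
    BddAbove ((fun z : ℂ => ‖(S.restrictTo Xp invariant_plus).resolventOp z‖) ''
      {z : ℂ | z.re ≤ 0})
  bounded_minus :
    BddAbove ((fun z : ℂ => ‖(S.restrictTo Xm invariant_minus).resolventOp z‖) ''
      {z : ℂ | 0 ≤ z.re})

/-- `S` is strictly dichotomous with respect to some decomposition of `X`. -/
def IsStrictlyDichotomous (S : X →ₗ.[ℂ] X) : Prop :=
  ∃ Xp Xm : Submodule ℂ X, S.IsStrictlyDichotomousWrt Xp Xm

end LinearPMap

/-! The projection of a strict dichotomy is a contour integral of the resolvent along the imaginary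
axis. Write `R z = (T - z)⁻¹`, `J = R 0`. The integral of `R` itself need not converge, but `R z *
J² + (z + 1)⁻¹ J²` decays like `|z|⁻²`, since `R z` behaves like `-1/z` on `D(T)`. Let `A` be its
integral. In the scalar case `T = λ`, closing the contour to the left or to the right gives `A = J²`
for `Re λ > 0` and `A = 0` for `Re λ < 0`. So a bounded `P` with `P J² = A` should be the projection
onto the part of `T` in the right half-plane.

For `S` such a `P_S` exists: the projection of its dichotomy (`exists_projection`). The regularising
terms cancel in the difference of the integrals for `T` and `S`, and `∫ (R_T - R_S)` converges in
norm by the `|λ|^{1+ε}` bound. Hence `P = P_S + (2πi)⁻¹ ∫ (R_T - R_S)` is bounded, and density of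
`D(S²) ∩ D(T²)` yields `P J² = A` for `T`.

Conversely, a bounded `P` with `P J² = A` forces a strict dichotomy. The Cauchy transform `F` of the
regularised resolvent solves `(T - w) F(w) = A` for `Re w < 0` and equals `R w * P * J²` in the
strip. Phragmén–Lindelöf carries the strip estimate `‖F(w) y‖ ≤ M ‖P‖ ‖J² y‖` to the whole left
half-plane, so `F(w) = G(w) J²` with `G` bounded: `R P` extends boundedly to the left. A contour
shift then gives `P² = P`, and `G` restricts to the resolvent of `T` on the range of `P`. Passing to
`-T` replaces `P` by `1 - P` and handles the other half-plane. -/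

open Complex MeasureTheory Filter Topology Set

noncomputable section

/-! ### Integration along the imaginary axis. -/

namespace AxisIntegral

variable {E : Type*} [NormedAddCommGroup E] [NormedSpace ℂ E]

/-- The integral `(2πi)⁻¹ ∫ f(z) dz` along the imaginary axis. -/
def axisIntegral (f : ℂ → E) : E := ((2 * Real.pi : ℝ)⁻¹ : ℝ) • ∫ t : ℝ, f (t * I)

/-- Integrability along the imaginary axis. -/
def AxisIntegrable {E : Type*} [NormedAddCommGroup E] (f : ℂ → E) : Prop := Integrable fun t : ℝ => f (t * I)

theorem re_ofReal_mul_I (t : ℝ) : ((t : ℂ) * I).re = 0 := by simp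

theorem norm_ofReal_mul_I (t : ℝ) : ‖(t : ℂ) * I‖ = |t| := by simp

theorem axisIntegrable_of_decay {E : Type*} [NormedAddCommGroup E] {f : ℂ → E} {C : ℝ}
    (hc : ContinuousOn f {z | z.re = 0})
    (hf : ∀ z : ℂ, z.re = 0 → ‖f z‖ * (1 + ‖z‖) ^ 2 ≤ C) : AxisIntegrable f := by
  have hcont : Continuous fun t : ℝ => f (t * I) :=
    hc.comp_continuous (by fun_prop) fun t => re_ofReal_mul_I t
  refine Integrable.mono' (integrable_inv_one_add_sq.const_mul C)
    hcont.aestronglyMeasurable (Eventually.of_forall fun t => ?_)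
  have h := hf (t * I) (re_ofReal_mul_I t)
  rw [norm_ofReal_mul_I] at h
  have h1 : (1 + t ^ 2) ≤ (1 + |t|) ^ 2 := by nlinarith [abs_nonneg t, sq_abs t]
  rw [← div_eq_mul_inv, le_div_iff₀ (by positivity)]
  exact (mul_le_mul_of_nonneg_left h1 (norm_nonneg _)).trans h

theorem AxisIntegrable.add {E : Type*} [NormedAddCommGroup E] {f g : ℂ → E}
    (hf : AxisIntegrable f) (hg : AxisIntegrable g) : AxisIntegrable fun z => f z + g z :=
  Integrable.add hf hg

theorem axisIntegral_add {f g : ℂ → E} (hf : AxisIntegrable f) (hg : AxisIntegrable g) :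
    axisIntegral (fun z => f z + g z) = axisIntegral f + axisIntegral g := by
  unfold axisIntegral
  rw [← smul_add, ← integral_add hf hg]

theorem axisIntegral_sub {f g : ℂ → E} (hf : AxisIntegrable f) (hg : AxisIntegrable g) :
    axisIntegral (fun z => f z - g z) = axisIntegral f - axisIntegral g := by
  unfold axisIntegral
  rw [← smul_sub, ← integral_sub hf hg]

theorem axisIntegral_neg (f : ℂ → E) :
    axisIntegral (fun z => -f z) = -axisIntegral f := by
  unfold axisIntegral
  rw [integral_neg, smul_neg]

theorem axisIntegral_comp_neg (f : ℂ → E) :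
    axisIntegral (fun z => f (-z)) = axisIntegral f := by
  unfold axisIntegral
  rw [← integral_neg_eq_self (fun t : ℝ => f (t * I))]
  simp

theorem AxisIntegrable.comp_neg {E : Type*} [NormedAddCommGroup E] {f : ℂ → E}
    (hf : AxisIntegrable f) : AxisIntegrable fun z => f (-z) := by
  simpa [AxisIntegrable] using Integrable.comp_neg hf

theorem AxisIntegrable.neg {E : Type*} [NormedAddCommGroup E] {f : ℂ → E}
    (hf : AxisIntegrable f) : AxisIntegrable fun z => -f z :=
  Integrable.neg hf

theorem axisIntegral_congr {f g : ℂ → E} (h : ∀ z : ℂ, z.re = 0 → f z = g z) :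
    axisIntegral f = axisIntegral g := by
  unfold axisIntegral
  congr 2
  ext t
  exact h _ (re_ofReal_mul_I t)

theorem AxisIntegrable.congr {E : Type*} [NormedAddCommGroup E] {f g : ℂ → E} (hf : AxisIntegrable f)
    (h : ∀ z : ℂ, z.re = 0 → f z = g z) : AxisIntegrable g := by
  have : (fun t : ℝ => f (t * I)) = fun t : ℝ => g (t * I) :=
    funext fun t => h _ (re_ofReal_mul_I t)
  unfold AxisIntegrable at hf ⊢
  rwa [← this]

theorem AxisIntegrable.clm_apply {F : Type*} [NormedAddCommGroup F] [NormedSpace ℂ F]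
    (L : E →L[ℂ] F) {f : ℂ → E} (hf : AxisIntegrable f) : AxisIntegrable fun z => L (f z) :=
  L.integrable_comp hf

theorem clm_axisIntegral {F : Type*} [NormedAddCommGroup F] [NormedSpace ℂ F]
    [CompleteSpace E] [CompleteSpace F]
    (L : E →L[ℂ] F) {f : ℂ → E} (hf : AxisIntegrable f) :
    L (axisIntegral f) = axisIntegral fun z => L (f z) := by
  unfold axisIntegral
  rw [L.integral_comp_comm hf, ← Complex.coe_smul, ← Complex.coe_smul, map_smul]

theorem AxisIntegrable.smul_const {f : ℂ → ℂ} (hf : AxisIntegrable f) (v : E) :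
    AxisIntegrable fun z => f z • v :=
  Integrable.smul_const hf v

theorem axisIntegral_smul_const [CompleteSpace E] {f : ℂ → ℂ} (v : E) :
    axisIntegral (fun z => f z • v) = axisIntegral f • v := by
  unfold axisIntegral
  rw [integral_smul_const, smul_assoc]

theorem norm_axisIntegral_le {f : ℂ → E} {g : ℝ → ℝ} (hg : Integrable g)
    (h : ∀ t : ℝ, ‖f (t * I)‖ ≤ g t) :
    ‖axisIntegral f‖ ≤ (2 * Real.pi)⁻¹ * ∫ t, g t := by
  unfold axisIntegral
  rw [norm_smul, Real.norm_of_nonneg (by positivity)]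
  gcongr
  exact norm_integral_le_of_norm_le hg (Eventually.of_forall h)

/-- A function with quadratic decay that is holomorphic in the left half-plane has vanishing
integral along the imaginary axis. -/
theorem axisIntegral_eq_zero_of_left [CompleteSpace E] {f : ℂ → E} {C : ℝ}
    (hc : ContinuousOn f {z | z.re ≤ 0}) (hd : DifferentiableOn ℂ f {z | z.re < 0})
    (hf : ∀ z : ℂ, z.re ≤ 0 → ‖f z‖ * (1 + ‖z‖) ^ 2 ≤ C) : axisIntegral f = 0 := by
  have hint : AxisIntegrable f :=
    axisIntegrable_of_decay (hc.mono fun z (hz : z.re = 0) => hz.le) fun z hz => hf z hz.le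
  have hlim : Tendsto (fun N : ℝ => ∫ t in (-N)..N, f (t * I)) atTop
      (𝓝 (∫ t : ℝ, f (t * I))) :=
    intervalIntegral_tendsto_integral hint tendsto_neg_atTop_atBot tendsto_id
  have hbd : ∀ {N : ℝ} {z : ℂ}, 0 < N → z.re ≤ 0 → N ≤ ‖z‖ → ‖f z‖ ≤ C / N ^ 2 := by
    intro N z hN hz hNz
    rw [le_div_iff₀ (by positivity)]
    refine le_trans ?_ (hf z hz)
    gcongr
    linarith
  -- Cauchy's theorem on `[-N, 0] × [-N, N]`: the three sides off the axis have total length `4N`,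
  -- and there `‖f‖ ≤ C / N²`.
  have hest : ∀ N : ℝ, 0 < N → ‖∫ t in (-N)..N, f (t * I)‖ ≤ 4 * C * N⁻¹ := by
    intro N hN
    have hrect := integral_boundary_rect_eq_zero_of_continuousOn_of_differentiableOn f
      (⟨-N, -N⟩ : ℂ) (⟨0, N⟩ : ℂ)
      (hc.mono ?_) (hd.mono ?_)
    · simp only at hrect
      have h1 : ‖∫ x : ℝ in (-N)..0, f (x + ((-N : ℝ) : ℂ) * I)‖ ≤ C / N ^ 2 * |0 - (-N)| := by
        refine intervalIntegral.norm_integral_le_of_norm_le_const fun x hx => hbd hN ?_ ?_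
        · rw [uIoc_of_le (by linarith)] at hx
          simpa using hx.2
        · refine le_trans ?_ (abs_im_le_norm _)
          simp [abs_of_pos hN]
      have h2 : ‖∫ x : ℝ in (-N)..0, f (x + ((N : ℝ) : ℂ) * I)‖ ≤ C / N ^ 2 * |0 - (-N)| := by
        refine intervalIntegral.norm_integral_le_of_norm_le_const fun x hx => hbd hN ?_ ?_
        · rw [uIoc_of_le (by linarith)] at hx
          simpa using hx.2
        · refine le_trans ?_ (abs_im_le_norm _)
          simp [abs_of_pos hN]
      have h3 : ‖∫ y : ℝ in (-N)..N, f (((-N : ℝ) : ℂ) + y * I)‖ ≤ C / N ^ 2 * |N - (-N)| := by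
        refine intervalIntegral.norm_integral_le_of_norm_le_const fun x hx => hbd hN ?_ ?_
        · simpa using hN.le
        · refine le_trans ?_ (abs_re_le_norm _)
          simp [abs_of_pos hN]
      have h4 : I • (∫ t : ℝ in (-N)..N, f (t * I)) =
          I • (∫ y : ℝ in (-N)..N, f (((-N : ℝ) : ℂ) + y * I))
          - (∫ x : ℝ in (-N)..0, f (x + ((-N : ℝ) : ℂ) * I))
          + ∫ x : ℝ in (-N)..0, f (x + ((N : ℝ) : ℂ) * I) := by
        simp only [ofReal_zero, zero_add] at hrect
        rw [← sub_eq_zero, ← hrect]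
        abel
      have h5 : ‖∫ t : ℝ in (-N)..N, f (t * I)‖ = ‖I • (∫ t : ℝ in (-N)..N, f (t * I))‖ := by
        rw [norm_smul, norm_I, one_mul]
      rw [h5, h4]
      refine (norm_add_le _ _).trans ?_
      refine (add_le_add (norm_sub_le _ _) le_rfl).trans ?_
      rw [norm_smul, norm_I, one_mul]
      refine (add_le_add (add_le_add h3 h1) h2).trans (le_of_eq ?_)
      rw [abs_of_pos (by linarith : (0 : ℝ) < N - -N), abs_of_pos (by linarith : (0 : ℝ) < 0 - -N)]
      field_simp
      ring
    · intro z hz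
      have h1 := hz.1
      rw [mem_preimage, uIcc_of_le (by linarith)] at h1
      exact h1.2
    · intro z hz
      have h1 := hz.1
      simp only [mem_preimage, mem_Ioo] at h1
      rw [max_eq_right (by linarith : -N ≤ 0)] at h1
      exact h1.2
  have hzero : Tendsto (fun N : ℝ => ∫ t in (-N)..N, f (t * I)) atTop (𝓝 0) := by
    refine squeeze_zero_norm' (a := fun N : ℝ => 4 * C * N⁻¹) ?_ ?_
    · filter_upwards [eventually_gt_atTop 0] with N hN using hest N hN
    · simpa using tendsto_inv_atTop_zero.const_mul (4 * C)
  unfold axisIntegral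
  rw [tendsto_nhds_unique hlim hzero, smul_zero]

theorem axisIntegral_eq_zero_of_right [CompleteSpace E] {f : ℂ → E} {C : ℝ}
    (hc : ContinuousOn f {z | 0 ≤ z.re}) (hd : DifferentiableOn ℂ f {z | 0 < z.re})
    (hf : ∀ z : ℂ, 0 ≤ z.re → ‖f z‖ * (1 + ‖z‖) ^ 2 ≤ C) : axisIntegral f = 0 := by
  rw [← axisIntegral_comp_neg]
  refine axisIntegral_eq_zero_of_left (C := C)
    (hc.comp continuous_neg.continuousOn fun z (hz : z.re ≤ 0) => ?_)
    (hd.comp differentiable_neg.differentiableOn fun z (hz : z.re < 0) => ?_) fun z hz => ?_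
  · simpa using hz
  · simpa using hz
  · simpa using hf (-z) (by simpa using hz)

theorem one_add_norm_le_mul_norm_sub {z w : ℂ} {a : ℝ} (ha : 0 < a) (h : a ≤ ‖z - w‖) :
    1 + ‖z‖ ≤ (1 + (1 + ‖w‖) / a) * ‖z - w‖ := by
  have h1 : ‖z‖ ≤ ‖z - w‖ + ‖w‖ := by simpa using norm_add_le (z - w) w
  have h2 : 1 + ‖w‖ ≤ (1 + ‖w‖) / a * ‖z - w‖ := by
    rw [div_mul_eq_mul_div, le_div_iff₀ ha]
    gcongr
  linarith

theorem norm_inv_mul_inv_decay {v w : ℂ} {a b : ℝ} (ha : 0 < a) (hb : 0 < b) {z : ℂ}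
    (hv : a ≤ ‖z - v‖) (hw : b ≤ ‖z - w‖) :
    ‖(z - v)⁻¹ * (z - w)⁻¹‖ * (1 + ‖z‖) ^ 2 ≤
      (1 + (1 + ‖v‖) / a) * (1 + (1 + ‖w‖) / b) := by
  have h1 := one_add_norm_le_mul_norm_sub ha hv
  have h2 := one_add_norm_le_mul_norm_sub hb hw
  have h3 : 0 < ‖z - v‖ := ha.trans_le hv
  have h4 : 0 < ‖z - w‖ := hb.trans_le hw
  rw [norm_mul, norm_inv, norm_inv, ← mul_inv, inv_mul_le_iff₀ (by positivity), pow_two]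
  calc (1 + ‖z‖) * (1 + ‖z‖)
      ≤ ((1 + (1 + ‖v‖) / a) * ‖z - v‖) * ((1 + (1 + ‖w‖) / b) * ‖z - w‖) := by gcongr
    _ = _ := by ring

theorem neg_re_le_norm_sub {z w : ℂ} (hz : 0 ≤ z.re) : -w.re ≤ ‖z - w‖ :=
  le_trans (by rw [sub_re]; linarith) (re_le_norm (z - w))

theorem sub_ne_zero_of_re {z w : ℂ} (hz : 0 ≤ z.re) (hw : w.re < 0) : z - w ≠ 0 := by
  intro h
  have := congrArg re h
  rw [sub_re, zero_re] at this
  linarith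

/-- `(2πi)⁻¹ ∫ dz / ((z - v)(z - w)) = 0` if both poles lie to the left of the axis. -/
theorem axisIntegral_inv_mul_inv {v w : ℂ} (hv : v.re < 0) (hw : w.re < 0) :
    axisIntegral (fun z => (z - v)⁻¹ * (z - w)⁻¹) = 0 := by
  have hd : DifferentiableOn ℂ (fun z => (z - v)⁻¹ * (z - w)⁻¹) {z | 0 ≤ z.re} := by
    intro z hz
    have h1 := sub_ne_zero_of_re hz hv
    have h2 := sub_ne_zero_of_re hz hw
    refine DifferentiableAt.differentiableWithinAt ?_
    fun_prop (disch := assumption)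
  exact axisIntegral_eq_zero_of_right hd.continuousOn (hd.mono fun z (hz : 0 < z.re) => hz.le)
    fun z hz => norm_inv_mul_inv_decay (neg_pos.2 hv) (neg_pos.2 hw)
      (neg_re_le_norm_sub hz) (neg_re_le_norm_sub hz)

theorem axisIntegrable_inv_mul_inv {v w : ℂ} (hv : v.re ≠ 0) (hw : w.re ≠ 0) :
    AxisIntegrable (fun z => (z - v)⁻¹ * (z - w)⁻¹) := by
  have key : ∀ {z u : ℂ}, z.re = 0 → |u.re| ≤ ‖z - u‖ := fun {z u} hz => by
    refine le_trans (le_of_eq ?_) (abs_re_le_norm (z - u))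
    rw [sub_re, hz, zero_sub, abs_neg]
  refine axisIntegrable_of_decay (fun z hz => ContinuousAt.continuousWithinAt ?_)
    fun z hz => norm_inv_mul_inv_decay (abs_pos.2 hv) (abs_pos.2 hw) (key hz) (key hz)
  have h1 : z - v ≠ 0 := norm_pos_iff.1 ((abs_pos.2 hv).trans_le (key hz))
  have h2 : z - w ≠ 0 := norm_pos_iff.1 ((abs_pos.2 hw).trans_le (key hz))
  fun_prop (disch := assumption)

theorem inv_sub_one_sub_inv_add_one {z : ℂ} (hz : z.re = 0) :
    (z - 1)⁻¹ - (z + 1)⁻¹ = 2 * ((z - 1)⁻¹ * (z - (-1))⁻¹) := by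
  have h1 : z - 1 ≠ 0 := fun h => by simpa [hz] using congrArg re h
  have h2 : z + 1 ≠ 0 := fun h => by simpa [hz] using congrArg re h
  rw [sub_neg_eq_add]
  field_simp
  ring

theorem axisIntegrable_inv_sub_one_sub_inv_add_one :
    AxisIntegrable fun z : ℂ => (z - 1)⁻¹ - (z + 1)⁻¹ := by
  refine AxisIntegrable.congr (f := fun z => 2 * ((z - 1)⁻¹ * (z - (-1))⁻¹)) ?_
    fun z hz => (inv_sub_one_sub_inv_add_one hz).symm
  exact (axisIntegrable_inv_mul_inv (by simp) (by simp)).const_mul 2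

/-- On the axis the integrand is `-2 / (1 + t²)`. This value normalises the projection: both `P² =
P` and the passage from `P` to `1 - P` under `T ↦ -T` reduce to it. -/
theorem axisIntegral_inv_sub_one_sub_inv_add_one :
    axisIntegral (fun z : ℂ => (z - 1)⁻¹ - (z + 1)⁻¹) = -1 := by
  have h : ∀ t : ℝ, ((t : ℂ) * I - 1)⁻¹ - ((t : ℂ) * I + 1)⁻¹ =
      (((-2 : ℝ) * (1 + t ^ 2)⁻¹ : ℝ) : ℂ) := by
    intro t
    rw [inv_sub_one_sub_inv_add_one (re_ofReal_mul_I t), ← mul_inv]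
    have : ((t : ℂ) * I - 1) * (t * I - -1) = -(1 + t ^ 2) := by
      ring_nf
      rw [I_sq]
      ring
    rw [this]
    push_cast
    rw [inv_neg]
    ring
  unfold axisIntegral
  simp only [h]
  rw [integral_complex_ofReal, integral_const_mul, integral_univ_inv_one_add_sq,
    real_smul, ← ofReal_mul]
  have := Real.pi_ne_zero
  rw [show (2 * Real.pi)⁻¹ * (-2 * Real.pi) = -1 by field_simp]
  simp

end AxisIntegral

/-! ### Resolvent identities, quadratic decay and bounded extensions to a half-plane. -/

namespace AxisIntegral

section ResolventIdentity

variable {A : Type*} [NormedRing A] [NormedAlgebra ℂ A]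

/-- No a priori bound on `F` is needed: once `‖z - w‖ ‖F w‖ < 1/2`, the identity absorbs half of `‖F
z‖` and gives `‖F z‖ ≤ 2 ‖F w‖`. -/
theorem continuousOn_of_resolvent_identity {F : ℂ → A} {U : Set ℂ}
    (hF : ∀ z ∈ U, ∀ w ∈ U, F z - F w = (z - w) • (F z * F w)) : ContinuousOn F U := by
  intro w hw
  have hlim : Tendsto (fun z => ‖z - w‖ * (2 * ‖F w‖ * ‖F w‖)) (𝓝[U] w) (𝓝 0) := by
    have : ContinuousAt (fun z => ‖z - w‖ * (2 * ‖F w‖ * ‖F w‖)) w := by fun_prop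
    simpa using this.tendsto.mono_left (nhdsWithin_le_nhds (s := U))
  have hsmall : ∀ᶠ z in 𝓝[U] w, ‖z - w‖ * ‖F w‖ < 1 / 2 := by
    have : ContinuousAt (fun z => ‖z - w‖ * ‖F w‖) w := by fun_prop
    exact (this.eventually_lt_const (by simp)).filter_mono nhdsWithin_le_nhds
  refine tendsto_iff_norm_sub_tendsto_zero.2 (squeeze_zero' (Eventually.of_forall fun z =>
    norm_nonneg _) ?_ hlim)
  filter_upwards [self_mem_nhdsWithin, hsmall] with z hz hzs
  have h1 : ‖F z - F w‖ ≤ ‖z - w‖ * (‖F z‖ * ‖F w‖) := by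
    rw [hF z hz w hw, norm_smul]
    gcongr
    exact norm_mul_le _ _
  have h2 : ‖F z‖ ≤ 2 * ‖F w‖ := by
    have h3 : ‖F z‖ ≤ ‖F z - F w‖ + ‖F w‖ := by simpa using norm_add_le (F z - F w) (F w)
    nlinarith [norm_nonneg (F z)]
  refine h1.trans ?_
  gcongr

theorem differentiableOn_of_resolvent_identity {F : ℂ → A} {U : Set ℂ} (hU : IsOpen U)
    (hF : ∀ z ∈ U, ∀ w ∈ U, F z - F w = (z - w) • (F z * F w)) : DifferentiableOn ℂ F U := by
  intro w hw
  have hc : ContinuousAt F w :=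
    (continuousOn_of_resolvent_identity hF).continuousAt (hU.mem_nhds hw)
  suffices HasDerivAt F (F w * F w) w from this.differentiableAt.differentiableWithinAt
  rw [hasDerivAt_iff_tendsto_slope]
  have h1 : Tendsto (fun z => F z * F w) (𝓝[≠] w) (𝓝 (F w * F w)) :=
    (hc.tendsto.mono_left nhdsWithin_le_nhds).mul_const _
  refine h1.congr' ?_
  filter_upwards [self_mem_nhdsWithin, nhdsWithin_le_nhds (hU.mem_nhds hw)] with z hz hzU
  rw [slope_def_module, hF z hzU w hw, smul_smul, inv_mul_cancel₀ (sub_ne_zero.2 hz), one_smul]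

theorem norm_mul_one_add_sq_le {z : ℂ} {x : A} {a b : ℝ} (ha : ‖x‖ ≤ a) (hb : ‖z ^ 2 • x‖ ≤ b) :
    ‖x‖ * (1 + ‖z‖) ^ 2 ≤ 2 * (a + b) := by
  rw [norm_smul, norm_pow] at hb
  nlinarith [sq_nonneg (1 - ‖z‖), norm_nonneg x, mul_nonneg (norm_nonneg x) (sq_nonneg (1 - ‖z‖))]

/-- If `G = J (P + z G)`, then `J² G + (z - s)⁻¹ J² P` decays quadratically. -/
theorem norm_mul_one_add_sq_le_of_eq {J P G : A} {z s : ℂ} {C : ℝ} (hs : ‖s‖ = 1)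
    (h1 : 1 ≤ ‖z - s‖) (h2 : ‖z‖ ≤ ‖z - s‖) (hG : G = J * (P + z • G)) (hC : ‖G‖ ≤ C) :
    ‖J * J * G + (z - s)⁻¹ • (J * J * P)‖ * (1 + ‖z‖) ^ 2 ≤
      2 * ((‖J * J‖ * C + ‖J * J * P‖) + (C + ‖J * P‖ + ‖J * J * P‖)) := by
  have h0 : z - s ≠ 0 := norm_pos_iff.1 (by linarith)
  refine norm_mul_one_add_sq_le ?_ ?_
  · refine (norm_add_le _ _).trans (add_le_add ?_ ?_)
    · exact (norm_mul_le _ _).trans (by gcongr)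
    · rw [norm_smul, norm_inv]
      exact mul_le_of_le_one_left (norm_nonneg _) (inv_le_one_of_one_le₀ h1)
  · have e1 : z • (J * G) = G - J * P := by
      conv_rhs => rw [hG]
      rw [mul_add, mul_smul_comm]
      abel
    have e2 : z ^ 2 • (J * J * G) = G - J * P - z • (J * J * P) := by
      rw [pow_two, mul_smul, mul_assoc, ← mul_smul_comm z J, e1, mul_sub, smul_sub, e1, mul_assoc]
    have e3 : z ^ 2 • (J * J * G + (z - s)⁻¹ • (J * J * P)) =
        G - J * P + (s * (z * (z - s)⁻¹)) • (J * J * P) := by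
      rw [smul_add, e2, smul_smul]
      have : z ^ 2 * (z - s)⁻¹ = z + s * (z * (z - s)⁻¹) := by
        field_simp
        ring
      rw [this, add_smul]
      abel
    rw [e3]
    refine (norm_add_le _ _).trans (add_le_add ((norm_sub_le _ _).trans (by gcongr)) ?_)
    rw [norm_smul, norm_mul, norm_mul, norm_inv, hs, one_mul]
    refine mul_le_of_le_one_left (norm_nonneg _) ?_
    rw [← div_eq_mul_inv]
    exact div_le_one_of_le₀ h2 (norm_nonneg _)

end ResolventIdentity

theorem one_le_norm_sub_one {z : ℂ} (hz : z.re ≤ 0) : 1 ≤ ‖z - 1‖ := by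
  have := neg_re_le_norm_sub (z := -z) (w := -1) (by simpa using hz)
  rwa [← neg_add', norm_neg, neg_re, one_re, neg_neg, ← sub_eq_add_neg] at this

theorem norm_le_norm_sub_one {z : ℂ} (hz : z.re ≤ 0) : ‖z‖ ≤ ‖z - 1‖ := by
  rw [Complex.norm_def, Complex.norm_def]
  refine Real.sqrt_le_sqrt ?_
  rw [normSq_apply, normSq_apply, sub_re, sub_im, one_re, one_im]
  nlinarith

theorem one_le_norm_add_one {z : ℂ} (hz : 0 ≤ z.re) : 1 ≤ ‖z - (-1)‖ := by
  have := one_le_norm_sub_one (z := -z) (by simpa using hz)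
  rwa [← neg_add', norm_neg, ← sub_neg_eq_add] at this

theorem norm_le_norm_add_one {z : ℂ} (hz : 0 ≤ z.re) : ‖z‖ ≤ ‖z - (-1)‖ := by
  have := norm_le_norm_sub_one (z := -z) (by simpa using hz)
  rwa [← neg_add', norm_neg, norm_neg, ← sub_neg_eq_add] at this

theorem sub_one_ne_zero {z : ℂ} (hz : z.re ≤ 0) : z - 1 ≠ 0 :=
  norm_pos_iff.1 (zero_lt_one.trans_le (one_le_norm_sub_one hz))

theorem add_one_ne_zero {z : ℂ} (hz : 0 ≤ z.re) : z + 1 ≠ 0 := by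
  rw [← sub_neg_eq_add]
  exact norm_pos_iff.1 (zero_lt_one.trans_le (one_le_norm_add_one hz))

variable {A : Type*} [NormedRing A] [NormedAlgebra ℂ A]

/-- `G` is a bounded solution of `G z = J (P + z G z)` on the closed left half-plane; if `J` is the
inverse of an operator `T` and `P` a projection commuting with `T`, this says that `G` is the
extension of `z ↦ (T - z)⁻¹ P` to the left half-plane. -/
structure IsLeftExtension (J P : A) (G : ℂ → A) (C : ℝ) : Prop where
  norm_le : ∀ z : ℂ, z.re ≤ 0 → ‖G z‖ ≤ C
  eq_mul : ∀ z : ℂ, z.re ≤ 0 → G z = J * (P + z • G z)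
  comm : ∀ z : ℂ, z.re ≤ 0 → G z * J = J * G z
  continuousOn : ContinuousOn (fun z => J * J * G z) {z | z.re ≤ 0}
  differentiableOn : DifferentiableOn ℂ (fun z => J * J * G z) {z | z.re < 0}

namespace IsLeftExtension

variable {J P : A} {G : ℂ → A} {C : ℝ}

theorem decay (hG : IsLeftExtension J P G C) (z : ℂ) (hz : z.re ≤ 0) :
    ‖J * J * G z + (z - 1)⁻¹ • (J * J * P)‖ * (1 + ‖z‖) ^ 2 ≤
      2 * ((‖J * J‖ * C + ‖J * J * P‖) + (C + ‖J * P‖ + ‖J * J * P‖)) :=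
  norm_mul_one_add_sq_le_of_eq norm_one (one_le_norm_sub_one hz) (norm_le_norm_sub_one hz)
    (hG.eq_mul z hz) (hG.norm_le z hz)

theorem continuousOn_add (hG : IsLeftExtension J P G C) :
    ContinuousOn (fun z => J * J * G z + (z - 1)⁻¹ • (J * J * P)) {z | z.re ≤ 0} := by
  refine hG.continuousOn.add fun z hz => ContinuousAt.continuousWithinAt ?_
  have := sub_one_ne_zero hz
  fun_prop (disch := assumption)

theorem axisIntegrable (hG : IsLeftExtension J P G C) :
    AxisIntegrable fun z => J * J * G z + (z - 1)⁻¹ • (J * J * P) :=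
  axisIntegrable_of_decay (hG.continuousOn_add.mono fun z (hz : z.re = 0) => hz.le)
    fun z hz => hG.decay z hz.le

theorem axisIntegral_eq_zero [CompleteSpace A] (hG : IsLeftExtension J P G C) :
    axisIntegral (fun z => J * J * G z + (z - 1)⁻¹ • (J * J * P)) = 0 := by
  refine axisIntegral_eq_zero_of_left hG.continuousOn_add
    (hG.differentiableOn.add fun z hz => DifferentiableAt.differentiableWithinAt ?_) hG.decay
  have := sub_one_ne_zero (z := z) (le_of_lt hz)
  fun_prop (disch := assumption)

end IsLeftExtension

theorem inv_add_one_smul_eq {E : Type*} [AddCommGroup E] [Module ℂ E] (z : ℂ) (x y : E) :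
    x + (z + 1)⁻¹ • y = (x + (z - 1)⁻¹ • y) - ((z - 1)⁻¹ - (z + 1)⁻¹) • y := by
  rw [sub_smul]
  abel

theorem AxisIntegrable.add_inv_add_one_smul {E : Type*} [NormedAddCommGroup E] [NormedSpace ℂ E]
    {f : ℂ → E} {y : E} (h : AxisIntegrable fun z => f z + (z - 1)⁻¹ • y) :
    AxisIntegrable fun z => f z + (z + 1)⁻¹ • y := by
  simp only [inv_add_one_smul_eq]
  exact h.sub (axisIntegrable_inv_sub_one_sub_inv_add_one.smul_const y)

/-- Changing the reference pole from `1` to `-1` changes the regularised integral by `y`. -/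
theorem axisIntegral_add_inv_add_one_smul {E : Type*} [NormedAddCommGroup E] [NormedSpace ℂ E]
    [CompleteSpace E] {f : ℂ → E} {y : E} (h : AxisIntegrable fun z => f z + (z - 1)⁻¹ • y) :
    axisIntegral (fun z => f z + (z + 1)⁻¹ • y) =
      axisIntegral (fun z => f z + (z - 1)⁻¹ • y) + y := by
  simp only [inv_add_one_smul_eq]
  rw [axisIntegral_sub h (axisIntegrable_inv_sub_one_sub_inv_add_one.smul_const y),
    axisIntegral_smul_const, axisIntegral_inv_sub_one_sub_inv_add_one, neg_one_smul,
    sub_neg_eq_add]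

end AxisIntegral

/-! ### The regularised resolvent and its Cauchy transform. -/

namespace AxisIntegral

variable {X : Type*} [NormedAddCommGroup X] [NormedSpace ℂ X]

/-- A bounded resolvent family on the strip `|Re z| ≤ h` such that `R 0` is injective and
`(R 0)²` has dense range. -/
structure IsStripFamily (R : ℂ → X →L[ℂ] X) (h M : ℝ) : Prop where
  pos : 0 < h
  norm_le : ∀ z : ℂ, |z.re| ≤ h → ‖R z‖ ≤ M
  identity : ∀ z w : ℂ, |z.re| ≤ h → |w.re| ≤ h → R z - R w = (z - w) • (R z * R w)
  injective : Function.Injective (R 0)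
  denseRange : DenseRange (R 0 * R 0)

namespace IsStripFamily

variable {R : ℂ → X →L[ℂ] X} {h M : ℝ}

theorem mem_zero (hR : IsStripFamily R h M) : |(0 : ℂ).re| ≤ h := by simpa using hR.pos.le

theorem mem_axis (hR : IsStripFamily R h M) {z : ℂ} (hz : z.re = 0) : |z.re| ≤ h := by
  simpa [hz] using hR.pos.le

theorem commute (hR : IsStripFamily R h M) {z w : ℂ} (hz : |z.re| ≤ h) (hw : |w.re| ≤ h) :
    R z * R w = R w * R z := by
  rcases eq_or_ne z w with rfl | hne
  · rfl
  have h1 := hR.identity z w hz hw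
  have h2 := hR.identity w z hw hz
  have h3 : (z - w) • (R z * R w) = (z - w) • (R w * R z) := by
    rw [← h1, ← neg_sub w z, neg_smul, ← h2, neg_sub]
  exact smul_right_injective _ (sub_ne_zero.2 hne) h3

theorem cancel_left (hR : IsStripFamily R h M) {B B' : X →L[ℂ] X} (hB : R 0 * B = R 0 * B') :
    B = B' := by
  ext x
  exact hR.injective (DFunLike.congr_fun hB x)

theorem cancel_right (hR : IsStripFamily R h M) {B B' : X →L[ℂ] X}
    (hB : B * (R 0 * R 0) = B' * (R 0 * R 0)) : B = B' := by
  refine ContinuousLinearMap.coeFn_injective (hR.denseRange.equalizer B.continuous B'.continuous ?_)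
  funext x
  exact DFunLike.congr_fun hB x

theorem eq_mul (hR : IsStripFamily R h M) {z : ℂ} (hz : |z.re| ≤ h) :
    R z = R 0 * (1 + z • R z) := by
  have h1 := hR.identity z 0 hz hR.mem_zero
  rw [sub_zero, hR.commute hz hR.mem_zero] at h1
  rw [mul_add, mul_one, mul_smul_comm, ← h1]
  abel

theorem continuousOn (hR : IsStripFamily R h M) : ContinuousOn R {z | |z.re| ≤ h} :=
  continuousOn_of_resolvent_identity fun z hz w hw => hR.identity z w hz hw

theorem isOpen_strip (h : ℝ) : IsOpen {z : ℂ | |z.re| < h} :=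
  isOpen_lt (by fun_prop) (by fun_prop)

theorem differentiableOn (hR : IsStripFamily R h M) : DifferentiableOn ℂ R {z | |z.re| < h} :=
  differentiableOn_of_resolvent_identity (isOpen_strip h)
    fun z (hz : |z.re| < h) w (hw : |w.re| < h) => hR.identity z w hz.le hw.le

/-- The family of `-T`, if `R` is the resolvent family of `T`. -/
theorem reflect (hR : IsStripFamily R h M) : IsStripFamily (fun z => -R (-z)) h M where
  pos := hR.pos
  norm_le z hz := by simpa using hR.norm_le (-z) (by simpa using hz)
  identity z w hz hw := by
    have := hR.identity (-w) (-z) (by simpa using hw) (by simpa using hz)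
    rw [hR.commute (by simpa using hw) (by simpa using hz)] at this
    rw [neg_mul_neg, sub_neg_eq_add, neg_add_eq_sub, this]
    congr 1
    ring
  injective x y hxy := hR.injective (by simpa using hxy)
  denseRange := by simpa using hR.denseRange

/-- The regularised resolvent `R(z) J² + (z + 1)⁻¹ J²`, `J = R(0)`. -/
def kernel (R : ℂ → X →L[ℂ] X) (z : ℂ) : X →L[ℂ] X :=
  R z * (R 0 * R 0) + (z + 1)⁻¹ • (R 0 * R 0)

theorem kernel_axisIntegrable (hR : IsStripFamily R h M) : AxisIntegrable (kernel R) := by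
  refine axisIntegrable_of_decay (C := 2 * ((‖R 0 * R 0‖ * M + ‖R 0 * R 0 * 1‖) +
    (M + ‖R 0 * 1‖ + ‖R 0 * R 0 * 1‖))) ?_ fun z hz => ?_
  · refine ((hR.continuousOn.mono fun z hz => hR.mem_axis hz).mul continuousOn_const).add
      fun z (hz : z.re = 0) => ContinuousAt.continuousWithinAt ?_
    have := add_one_ne_zero hz.ge
    fun_prop (disch := assumption)
  · have hz' := hR.mem_axis hz
    have := norm_mul_one_add_sq_le_of_eq (s := -1) (by simp) (one_le_norm_add_one hz.ge)
      (norm_le_norm_add_one hz.ge) (hR.eq_mul hz') (hR.norm_le z hz')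
    rwa [sub_neg_eq_add, mul_one, mul_assoc, hR.commute hR.mem_zero hz', ← mul_assoc,
      hR.commute hR.mem_zero hz', mul_assoc] at this

/-- The value at `w`, `Re w < 0`, of the extension of `R(w) ∫ kernel` to the left half-plane. -/
def cauchyTransform (R : ℂ → X →L[ℂ] X) (w : ℂ) : X →L[ℂ] X :=
  axisIntegral fun z => (z - w)⁻¹ • kernel R z

theorem norm_inv_sub_le {w : ℂ} {a : ℝ} (ha : 0 < a) (hw : w.re ≤ -a) {z : ℂ} (hz : z.re = 0) :
    ‖(z - w)⁻¹‖ ≤ a⁻¹ := by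
  rw [norm_inv]
  gcongr
  exact le_trans (by linarith) (neg_re_le_norm_sub hz.ge)

theorem continuous_inv_sub {w : ℂ} (hw : w.re < 0) :
    Continuous fun t : ℝ => ((t : ℂ) * I - w)⁻¹ :=
  Continuous.inv₀ (by fun_prop) fun t => sub_ne_zero_of_re (re_ofReal_mul_I t).ge hw

theorem axisIntegrable_inv_smul_kernel (hR : IsStripFamily R h M) {w : ℂ} (hw : w.re < 0) :
    AxisIntegrable fun z => (z - w)⁻¹ • kernel R z := by
  refine Integrable.bdd_smul hR.kernel_axisIntegrable (-w.re)⁻¹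
    (continuous_inv_sub hw).aestronglyMeasurable (Eventually.of_forall fun t => ?_)
  exact norm_inv_sub_le (by linarith) (by linarith) (re_ofReal_mul_I t)

theorem norm_cauchyTransform_le (hR : IsStripFamily R h M) {a : ℝ} (ha : 0 < a) {w : ℂ}
    (hw : w.re ≤ -a) :
    ‖cauchyTransform R w‖ ≤ (2 * Real.pi)⁻¹ * ∫ t : ℝ, a⁻¹ * ‖kernel R (t * I)‖ := by
  refine norm_axisIntegral_le (hR.kernel_axisIntegrable.norm.const_mul _) fun t => ?_
  rw [norm_smul]
  gcongr
  exact norm_inv_sub_le ha hw (re_ofReal_mul_I t)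

theorem differentiableOn_cauchyTransform (hR : IsStripFamily R h M) :
    DifferentiableOn ℂ (cauchyTransform R) {w | w.re < 0} := by
  intro w₀ (hw₀ : w₀.re < 0)
  refine DifferentiableAt.differentiableWithinAt ?_
  -- The half-plane `Re w < -a` contains `w₀` and stays at distance at least `a` from the axis,
  -- which makes the dominating function uniform in `w`.
  set a : ℝ := -w₀.re / 2 with ha_def
  have ha : 0 < a := by linarith
  have hs : {w : ℂ | w.re < -a} ∈ 𝓝 w₀ :=
    (isOpen_lt (by fun_prop) (by fun_prop)).mem_nhds (by simp only [mem_ofPred_eq]; linarith)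
  have hneg : ∀ w : ℂ, w.re < -a → w.re < 0 := fun w hw => by linarith
  have key := hasDerivAt_integral_of_dominated_loc_of_deriv_le (𝕜 := ℂ) (μ := volume)
    (F := fun w (t : ℝ) => ((t : ℂ) * I - w)⁻¹ • kernel R (t * I))
    (F' := fun w (t : ℝ) => (((t : ℂ) * I - w)⁻¹ ^ 2) • kernel R (t * I))
    (bound := fun t : ℝ => a⁻¹ ^ 2 * ‖kernel R (t * I)‖) (x₀ := w₀) hs ?_ ?_ ?_ ?_ ?_ ?_
  · exact key.2.differentiableAt.const_smul ((2 * Real.pi : ℝ)⁻¹ : ℝ)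
  · filter_upwards [hs] with w hw
    exact (hR.axisIntegrable_inv_smul_kernel (hneg w hw)).aestronglyMeasurable
  · exact hR.axisIntegrable_inv_smul_kernel hw₀
  · exact ((continuous_inv_sub hw₀).pow 2).aestronglyMeasurable.smul
      hR.kernel_axisIntegrable.aestronglyMeasurable
  · refine Eventually.of_forall fun t w hw => ?_
    rw [norm_smul, norm_pow]
    gcongr
    exact norm_inv_sub_le ha (le_of_lt hw) (re_ofReal_mul_I t)
  · exact hR.kernel_axisIntegrable.norm.const_mul _
  · refine Eventually.of_forall fun t w hw => ?_
    have hne := sub_ne_zero_of_re (re_ofReal_mul_I t).ge (hneg w hw)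
    have h1 : HasDerivAt (fun w : ℂ => (t : ℂ) * I - w) (-1) w := by
      simpa using (hasDerivAt_id w).const_sub ((t : ℂ) * I)
    have h2 := (h1.inv hne).smul_const (kernel R (t * I))
    rwa [neg_neg, one_div, ← inv_pow] at h2

theorem kernel_commute (hR : IsStripFamily R h M) {z w : ℂ} (hz : z.re = 0) (hw : |w.re| ≤ h) :
    R w * kernel R z = kernel R z * R w := by
  have h0 : R w * (R 0 * R 0) = (R 0 * R 0) * R w := by
    rw [← mul_assoc, hR.commute hw hR.mem_zero, mul_assoc, hR.commute hw hR.mem_zero, mul_assoc]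
  rw [kernel, mul_add, add_mul, mul_smul_comm, smul_mul_assoc, h0, mul_assoc (R z), ← h0,
    ← mul_assoc, hR.commute hw (hR.mem_axis hz), mul_assoc (R z)]

variable [CompleteSpace X]

theorem mul_axisIntegral (B : X →L[ℂ] X) {f : ℂ → X →L[ℂ] X} (hf : AxisIntegrable f) :
    B * axisIntegral f = axisIntegral fun z => B * f z :=
  clm_axisIntegral (ContinuousLinearMap.mul ℂ (X →L[ℂ] X) B) hf

theorem axisIntegral_mul (B : X →L[ℂ] X) {f : ℂ → X →L[ℂ] X} (hf : AxisIntegrable f) :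
    axisIntegral f * B = axisIntegral fun z => f z * B :=
  clm_axisIntegral ((ContinuousLinearMap.mul ℂ (X →L[ℂ] X)).flip B) hf

theorem integral_kernel_commute (hR : IsStripFamily R h M) {w : ℂ} (hw : |w.re| ≤ h) :
    R w * axisIntegral (kernel R) = axisIntegral (kernel R) * R w := by
  rw [mul_axisIntegral _ hR.kernel_axisIntegrable, axisIntegral_mul _ hR.kernel_axisIntegrable]
  exact axisIntegral_congr fun z hz => hR.kernel_commute hz hw

theorem cauchyTransform_commute (hR : IsStripFamily R h M) {w : ℂ} (hw : w.re < 0) :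
    R 0 * cauchyTransform R w = cauchyTransform R w * R 0 := by
  rw [cauchyTransform, mul_axisIntegral _ (hR.axisIntegrable_inv_smul_kernel hw),
    axisIntegral_mul _ (hR.axisIntegrable_inv_smul_kernel hw)]
  refine axisIntegral_congr fun z hz => ?_
  rw [mul_smul_comm, smul_mul_assoc, hR.kernel_commute hz hR.mem_zero]

/-- This is `(T - w) F(w) = A` in bounded form. Since `1 + w / (z - w) = z / (z - w)` and `z J` acts
on the kernel as the identity up to `(z + 1)⁻¹ (J² + J³)`, the error is a scalar integral with poles
`-1` and `w`. Both lie left of the axis, so it vanishes. -/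
theorem cauchyTransform_eq (hR : IsStripFamily R h M) {w : ℂ} (hw : w.re < 0) :
    cauchyTransform R w =
      R 0 * (axisIntegral (kernel R) + w • cauchyTransform R w) := by
  set J := R 0 with hJ
  have hi := hR.axisIntegrable_inv_smul_kernel hw
  have hsc : AxisIntegrable fun z : ℂ => (z - (-1))⁻¹ * (z - w)⁻¹ :=
    axisIntegrable_inv_mul_inv (by simp) hw.ne
  rw [mul_add, mul_smul_comm, ← smul_mul_assoc, mul_axisIntegral _ hR.kernel_axisIntegrable,
    cauchyTransform, mul_axisIntegral _ hi]
  have e1 : AxisIntegrable fun z => J * kernel R z :=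
    hR.kernel_axisIntegrable.clm_apply (ContinuousLinearMap.mul ℂ (X →L[ℂ] X) J)
  have e2 : AxisIntegrable fun z => (w • J) * ((z - w)⁻¹ • kernel R z) :=
    hi.clm_apply (ContinuousLinearMap.mul ℂ (X →L[ℂ] X) (w • J))
  rw [← axisIntegral_add e1 e2]
  have e3 : ∀ z : ℂ, z.re = 0 → J * kernel R z + (w • J) * ((z - w)⁻¹ • kernel R z) =
      (z - w)⁻¹ • kernel R z - ((z - (-1))⁻¹ * (z - w)⁻¹) • (J * J + J * (J * J)) := by
    intro z hz
    have hzw := sub_ne_zero_of_re hz.ge hw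
    have hz1 := add_one_ne_zero hz.ge
    have f1 : z • (J * R z) = R z - J := by
      have := hR.eq_mul (hR.mem_axis hz)
      rw [mul_add, mul_one, mul_smul_comm] at this
      rw [eq_sub_iff_add_eq, add_comm]
      exact this.symm
    have f2 : z • (J * kernel R z) = kernel R z - (z + 1)⁻¹ • (J * J + J * (J * J)) := by
      rw [kernel, ← hJ, mul_add, smul_add, mul_smul_comm, ← mul_assoc J (R z), ← smul_mul_assoc,
        f1, smul_smul, show z * (z + 1)⁻¹ = 1 - (z + 1)⁻¹ by field_simp; ring, sub_smul,
        one_smul, sub_mul, smul_add]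
      abel
    have f3 : J * kernel R z + (w • J) * ((z - w)⁻¹ • kernel R z) =
        (z - w)⁻¹ • (z • (J * kernel R z)) := by
      rw [smul_mul_assoc, mul_smul_comm, smul_smul, smul_smul]
      have : (z - w)⁻¹ * z = 1 + w * (z - w)⁻¹ := by field_simp; ring
      rw [this, add_smul, one_smul]
    rw [f3, f2, smul_sub, smul_smul, sub_neg_eq_add, mul_comm (z - w)⁻¹]
  rw [axisIntegral_congr e3, axisIntegral_sub hi (hsc.smul_const _), axisIntegral_smul_const,
    axisIntegral_inv_mul_inv (by simp) hw, zero_smul, sub_zero]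

/-- In the strip `T - w` is invertible, so the equation `(T - w) F(w) = A` has only the solution `R
w * A`. -/
theorem cauchyTransform_eq_mul (hR : IsStripFamily R h M) {w : ℂ} (hw : w.re < 0)
    (hw' : |w.re| ≤ h) : cauchyTransform R w = R w * axisIntegral (kernel R) := by
  have h1 := hR.cauchyTransform_eq hw
  have h2 : R w - w • (R w * R 0) = R 0 := by
    have := hR.identity w 0 hw' hR.mem_zero
    rw [sub_zero] at this
    rw [← this]
    abel
  refine hR.cancel_left ?_
  rw [← mul_assoc, ← hR.commute hw' hR.mem_zero]
  nth_rewrite 1 [← h2]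
  rw [sub_mul, smul_mul_assoc]
  nth_rewrite 1 [h1]
  rw [mul_add, mul_add, mul_smul_comm, mul_smul_comm, ← mul_assoc, ← mul_assoc]
  abel

end IsStripFamily

end AxisIntegral

/-! ### From the regularised integral to a projection and a bounded extension. -/

namespace AxisIntegral.IsStripFamily

variable {X : Type*} [NormedAddCommGroup X] [NormedSpace ℂ X] [CompleteSpace X]
  {R : ℂ → X →L[ℂ] X} {h M : ℝ} {P : X →L[ℂ] X}

theorem projection_commute (hR : IsStripFamily R h M)
    (hP : P * (R 0 * R 0) = axisIntegral (kernel R)) {w : ℂ} (hw : |w.re| ≤ h) :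
    R w * P = P * R w := by
  refine hR.cancel_right ?_
  have h0 : (R 0 * R 0) * R w = R w * (R 0 * R 0) := by
    rw [mul_assoc, ← hR.commute hw hR.mem_zero, ← mul_assoc, ← hR.commute hw hR.mem_zero, mul_assoc]
  rw [mul_assoc, hP, hR.integral_kernel_commute hw, ← hP, mul_assoc, h0, mul_assoc]

/-- The Phragmén–Lindelöf principle bounds the Cauchy transform by its values in the strip. -/
theorem norm_cauchyTransform_apply_le (hR : IsStripFamily R h M)
    (hP : P * (R 0 * R 0) = axisIntegral (kernel R)) {w : ℂ} (hw : w.re < 0) (y : X) :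
    ‖cauchyTransform R w y‖ ≤ M * ‖P‖ * ‖(R 0 * R 0) y‖ := by
  -- In the strip `F(w) y = R w (P (J² y))`. The bound in terms of `‖J² y‖`, not `‖y‖`, is what
  -- later allows `J²` to be divided out.
  have hstrip : ∀ w : ℂ, w.re < 0 → |w.re| ≤ h →
      ‖cauchyTransform R w y‖ ≤ M * ‖P‖ * ‖(R 0 * R 0) y‖ := by
    intro w hw hw'
    rw [hR.cauchyTransform_eq_mul hw hw', ← hP]
    calc ‖R w (P ((R 0 * R 0) y))‖ ≤ ‖R w‖ * (‖P‖ * ‖(R 0 * R 0) y‖) :=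
          ((R w).le_opNorm _).trans (by gcongr; exact P.le_opNorm _)
      _ ≤ M * (‖P‖ * ‖(R 0 * R 0) y‖) := by gcongr; exact hR.norm_le w hw'
      _ = _ := by ring
  rcases le_or_gt (-h) w.re with hle | hlt
  · exact hstrip w hw (abs_le.2 ⟨hle, hw.le.trans hR.pos.le⟩)
  have hpos := hR.pos
  -- The half-plane `Re w ≤ -h` is mapped to `Re u ≥ 0`. Its boundary line lies in the strip, and at
  -- distance `h` from the axis the Cauchy transform is bounded, so the growth condition holds with
  -- exponent `1 < 2` and constant `0`.
  set f : ℂ → X := fun u => cauchyTransform R (-(h : ℂ) - u) y with hf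
  have hre : ∀ u : ℂ, (-(h : ℂ) - u).re = -h - u.re := fun u => by simp
  have hd : DifferentiableOn ℂ f {u | 0 ≤ u.re} := by
    have h1 : DifferentiableOn ℂ (fun u => cauchyTransform R (-(h : ℂ) - u)) {u | 0 ≤ u.re} := by
      refine hR.differentiableOn_cauchyTransform.comp (by fun_prop) fun u (hu : 0 ≤ u.re) => ?_
      show (-(h : ℂ) - u).re < 0
      rw [hre]
      linarith
    exact h1.clm_apply (differentiableOn_const y)
  have hb : ∀ u : ℂ, 0 ≤ u.re →
      ‖f u‖ ≤ ((2 * Real.pi)⁻¹ * ∫ t : ℝ, h⁻¹ * ‖kernel R (t * I)‖) * ‖y‖ := by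
    intro u hu
    refine (ContinuousLinearMap.le_opNorm _ _).trans ?_
    gcongr
    refine hR.norm_cauchyTransform_le hpos ?_
    rw [hre]
    linarith
  have hcl : DiffContOnCl ℂ f {u | 0 < u.re} := by
    refine DifferentiableOn.diffContOnCl ?_
    rwa [Complex.closure_setOfPred_lt_re]
  have := PhragmenLindelof.right_half_plane_of_bounded_on_real (f := f) (z := -(h : ℂ) - w)
    (C := M * ‖P‖ * ‖(R 0 * R 0) y‖) hcl ⟨1, by norm_num, 0, ?_⟩ ?_ ?_ ?_
  · simpa [hf] using this
  · refine Asymptotics.IsBigO.of_bound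
      (((2 * Real.pi)⁻¹ * ∫ t : ℝ, h⁻¹ * ‖kernel R (t * I)‖) * ‖y‖) ?_
    refine eventually_inf_principal.2 (Eventually.of_forall fun u (hu : 0 < u.re) => ?_)
    simpa using hb u hu.le
  · refine isBoundedUnder_of_eventually_le
      (a := ((2 * Real.pi)⁻¹ * ∫ t : ℝ, h⁻¹ * ‖kernel R (t * I)‖) * ‖y‖) ?_
    filter_upwards [eventually_ge_atTop (0 : ℝ)] with x hx
    exact hb x (by simpa using hx)
  · intro x
    refine hstrip _ ?_ ?_ <;> rw [hre] <;> simp [hpos, abs_of_pos hpos]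
  · rw [hre]
    linarith

/-- If `P` is given by the regularised resolvent integral, then `R(z) P` extends boundedly to the
left half-plane. -/
theorem exists_isLeftExtension (hR : IsStripFamily R h M)
    (hP : P * (R 0 * R 0) = axisIntegral (kernel R)) :
    ∃ (G : ℂ → X →L[ℂ] X) (C : ℝ), IsLeftExtension (R 0) P G C ∧
      ∀ z : ℂ, z.re = 0 → G z = R z * P := by
  classical
  set J := R 0 with hJ
  have hM : 0 ≤ M := (norm_nonneg _).trans (hR.norm_le 0 hR.mem_zero)
  have hJP : J * P = P * J := hR.projection_commute hP hR.mem_zero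
  -- For `Re w < 0` the bound by `‖J² y‖` lets the Cauchy transform factor through `J²`, whose range
  -- is dense.
  let e : ℂ → X →L[ℂ] X := fun w =>
    (cauchyTransform R w : X →ₗ[ℂ] X).extendOfNorm ((J * J : X →L[ℂ] X) : X →ₗ[ℂ] X)
  have hdense : DenseRange ((J * J : X →L[ℂ] X) : X →ₗ[ℂ] X) := hR.denseRange
  have he : ∀ w : ℂ, w.re < 0 → e w * (J * J) = cauchyTransform R w := by
    intro w hw
    ext y
    exact LinearMap.extendOfNorm_eq hdense ⟨_, hR.norm_cauchyTransform_apply_le hP hw⟩ y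
  -- The Cauchy transform is of use only for `Re w < 0`, so `R w * P` is taken in the strip, in
  -- particular on the axis.
  let G : ℂ → X →L[ℂ] X := fun w => if |w.re| ≤ h then R w * P else e w
  have hG1 : ∀ w : ℂ, |w.re| ≤ h → G w = R w * P := fun w hw => if_pos hw
  have hG2 : ∀ w : ℂ, w.re < 0 → G w * (J * J) = cauchyTransform R w := by
    intro w hw
    by_cases hw' : |w.re| ≤ h
    · rw [hG1 w hw', mul_assoc, hP, hR.cauchyTransform_eq_mul hw hw']
    · simp only [G, if_neg hw', he w hw]
  have hcases : ∀ w : ℂ, w.re ≤ 0 → |w.re| ≤ h ∨ w.re < 0 := by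
    intro w hw
    rcases hw.lt_or_eq with h1 | h1
    · exact Or.inr h1
    · exact Or.inl (hR.mem_axis h1)
  have hcomm : ∀ w : ℂ, w.re ≤ 0 → G w * J = J * G w := by
    intro w hw
    rcases hcases w hw with h1 | h1
    · rw [hG1 w h1, mul_assoc, ← hJP, ← mul_assoc, ← mul_assoc, hR.commute h1 hR.mem_zero]
    · refine hR.cancel_right ?_
      have e1 : J * (J * J) = J * J * J := (mul_assoc _ _ _).symm
      rw [mul_assoc, e1, ← mul_assoc, hG2 w h1, mul_assoc, hG2 w h1,
        hR.cauchyTransform_commute h1]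
  have hcomm2 : ∀ w : ℂ, w.re ≤ 0 → J * J * G w = G w * (J * J) := by
    intro w hw
    rw [mul_assoc, ← hcomm w hw, ← mul_assoc, ← hcomm w hw, mul_assoc]
  have hdiff_strip : DifferentiableOn ℂ (fun z => J * J * (R z * P)) {z | |z.re| < h} :=
    (hR.differentiableOn.mul_const P).const_mul (J * J)
  refine ⟨G, M * ‖P‖, ⟨?_, ?_, hcomm, ?_, ?_⟩, fun z hz => hG1 z (hR.mem_axis hz)⟩
  · intro w hw
    by_cases hw' : |w.re| ≤ h
    · rw [hG1 w hw']
      refine (norm_mul_le _ _).trans ?_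
      gcongr
      exact hR.norm_le w hw'
    · have h1 := (hcases w hw).resolve_left hw'
      simp only [G, if_neg hw']
      exact LinearMap.opNorm_extendOfNorm_le hdense (by positivity)
        (hR.norm_cauchyTransform_apply_le hP h1)
  · intro w hw
    rcases hcases w hw with h1 | h1
    · rw [hG1 w h1]
      nth_rewrite 1 [hR.eq_mul h1]
      rw [mul_assoc, add_mul, one_mul, smul_mul_assoc]
    · refine hR.cancel_right ?_
      rw [hG2 w h1, mul_assoc, add_mul, smul_mul_assoc, hG2 w h1, hP, ← hR.cauchyTransform_eq h1]
  -- Near the axis continuity comes from `R`; left of it `J² G` is the Cauchy transform. This is why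
  -- regularity is asked of `J² G` and not of `G`.
  · intro w (hw : w.re ≤ 0)
    refine ContinuousAt.continuousWithinAt ?_
    by_cases hw' : |w.re| < h
    · have hn := (isOpen_strip h).mem_nhds hw'
      refine (hdiff_strip.continuousOn.continuousAt hn).congr ?_
      filter_upwards [hn] with z hz
      rw [hG1 z (le_of_lt hz)]
    · have h1 : w.re < 0 := by
        rcases hw.lt_or_eq with h2 | h2
        · exact h2
        · exact absurd (by simpa [h2] using hR.pos) hw'
      have hn : {z : ℂ | z.re < 0} ∈ 𝓝 w :=
        (isOpen_lt (by fun_prop) (by fun_prop)).mem_nhds h1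
      refine (hR.differentiableOn_cauchyTransform.continuousOn.continuousAt hn).congr ?_
      filter_upwards [hn] with z hz
      rw [hcomm2 z (le_of_lt hz), hG2 z hz]
  · exact hR.differentiableOn_cauchyTransform.congr fun z hz => by
      rw [hcomm2 z (le_of_lt hz), hG2 z hz]

/-- `P A` is the integral of `J² G + (z + 1)⁻¹ J² P`. With the pole at `1` in place of `-1` the
integrand is holomorphic on the left and integrates to zero; moving the pole contributes `J² P`.
Hence `P² J² = J² P = P J²`, and the dense range of `J²` gives `P² = P`. -/
theorem isIdempotentElem (hR : IsStripFamily R h M)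
    (hP : P * (R 0 * R 0) = axisIntegral (kernel R)) : P * P = P := by
  obtain ⟨G, C, hG, hGR⟩ := hR.exists_isLeftExtension hP
  have hPJ : P * (R 0 * R 0) = R 0 * R 0 * P := by
    have := hR.projection_commute hP hR.mem_zero
    rw [← mul_assoc, ← this, mul_assoc, ← this, mul_assoc]
  refine hR.cancel_right ?_
  rw [mul_assoc, hP, mul_axisIntegral _ hR.kernel_axisIntegrable, ← hP, hPJ]
  have h1 : ∀ z : ℂ, z.re = 0 → P * kernel R z =
      R 0 * R 0 * G z + (z + 1)⁻¹ • (R 0 * R 0 * P) := by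
    intro z hz
    have hz' := hR.mem_axis hz
    rw [kernel, mul_add, mul_smul_comm, hPJ, hGR z hz, ← mul_assoc,
      ← hR.projection_commute hP hz', mul_assoc, hPJ, ← mul_assoc, ← mul_assoc, ← mul_assoc,
      hR.commute hz' hR.mem_zero, mul_assoc (R 0), hR.commute hz' hR.mem_zero, ← mul_assoc]
  rw [axisIntegral_congr h1, axisIntegral_add_inv_add_one_smul hG.axisIntegrable,
    hG.axisIntegral_eq_zero, zero_add]

/-- The kernel of `-T` at `-z` is minus that of `T` at `z`, up to the difference of the reference
poles `1` and `-1`, which integrates to `J²`. So `-T` satisfies the same hypothesis with `1 - P`. -/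
theorem kernel_reflect (hR : IsStripFamily R h M)
    (hP : P * (R 0 * R 0) = axisIntegral (kernel R)) :
    (1 - P) * ((fun z => -R (-z)) 0 * (fun z => -R (-z)) 0) =
      axisIntegral (kernel fun z => -R (-z)) := by
  have e0 : (fun z => -R (-z)) 0 * (fun z => -R (-z)) 0 = R 0 * R 0 := by simp
  have e1 : ∀ z : ℂ, z.re = 0 → kernel (fun z => -R (-z)) (-z) =
      ((z - 1)⁻¹ - (z + 1)⁻¹) • -(R 0 * R 0) - kernel R z := by
    intro z hz
    have : (-z + 1 : ℂ)⁻¹ = -(z - 1)⁻¹ := by rw [← inv_neg]; congr 1; ring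
    simp only [kernel, neg_neg, neg_zero, neg_mul, mul_neg, this]
    module
  rw [e0, ← axisIntegral_comp_neg, axisIntegral_congr e1,
    axisIntegral_sub (axisIntegrable_inv_sub_one_sub_inv_add_one.smul_const _)
      hR.kernel_axisIntegrable, axisIntegral_smul_const,
    axisIntegral_inv_sub_one_sub_inv_add_one, neg_smul_neg, one_smul, sub_mul, one_mul, hP]

end AxisIntegral.IsStripFamily

/-! ### Resolvents of unbounded operators and of their restrictions. -/

namespace LinearPMap

open AxisIntegral

variable {X : Type*} [NormedAddCommGroup X] [NormedSpace ℂ X] {S : X →ₗ.[ℂ] X}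

namespace IsResolventAt

variable {z w : ℂ} {R R' : X →L[ℂ] X}

/-- A solution `x ∈ D(S)` of `S x = y + z x` is `R y`. -/
theorem apply_eq (hR : S.IsResolventAt z R) {x y : X} (hx : x ∈ S.domain)
    (hxy : S ⟨x, hx⟩ = y + z • x) : R y = x := by
  have := hR.2 ⟨x, hx⟩
  rwa [hxy, add_sub_cancel_right] at this

theorem mem_domain (hR : S.IsResolventAt z R) (y : X) : R y ∈ S.domain := (hR.1 y).1

theorem map_apply (hR : S.IsResolventAt z R) (y : X) :
    S ⟨R y, hR.mem_domain y⟩ = y + z • R y := by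
  rw [← sub_eq_iff_eq_add]
  exact (hR.1 y).2

theorem identity (hR : S.IsResolventAt z R) (hR' : S.IsResolventAt w R') :
    R - R' = (z - w) • (R * R') := by
  ext y
  have h1 : R (S ⟨R' y, hR'.mem_domain y⟩ - z • R' y) = R' y := hR.2 ⟨R' y, hR'.mem_domain y⟩
  rw [hR'.map_apply, add_sub_assoc, ← sub_smul, _root_.map_add, _root_.map_smul] at h1
  show R y - R' y = (z - w) • R (R' y)
  nth_rewrite 1 [← h1]
  rw [← neg_sub z w, neg_smul]
  abel

theorem unique (hR : S.IsResolventAt z R) (hR' : S.IsResolventAt z R') : R = R' := by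
  have := hR.identity hR'
  rwa [sub_self, zero_smul, sub_eq_zero] at this

theorem resolventOp_eq (hR : S.IsResolventAt z R) : S.resolventOp z = R := by
  have h : ∃ R : X →L[ℂ] X, S.IsResolventAt z R := ⟨R, hR⟩
  rw [resolventOp, dif_pos h]
  exact h.choose_spec.unique hR

theorem injective (hR : S.IsResolventAt z R) : Function.Injective R := by
  intro x y hxy
  have h1 := hR.map_apply x
  have h2 := hR.map_apply y
  simp only [hxy] at h1
  rw [h1] at h2
  exact add_right_cancel h2

theorem exists_eq_of_mem_domainSq (hR : S.IsResolventAt 0 R) {x : X} (hx : x ∈ S.domainSq) :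
    ∃ y, (R * R) y = x := by
  obtain ⟨h1, h2⟩ := hx
  refine ⟨S ⟨_, h2⟩, ?_⟩
  show R (R (S ⟨_, h2⟩)) = x
  have e1 : R (S ⟨_, h2⟩) = S ⟨x, h1⟩ := hR.apply_eq h2 (by simp)
  rw [e1, hR.apply_eq h1 (by simp)]

end IsResolventAt

theorem isResolventAt_resolventOp {z : ℂ} (hz : z ∈ S.resolventSet) :
    S.IsResolventAt z (S.resolventOp z) := by
  obtain ⟨R, hR⟩ := hz
  rwa [hR.resolventOp_eq]

section Restriction

variable {M N : Submodule ℂ X} {J P : X →L[ℂ] X}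

/-- For `x` in `D(S) ∩ M`, `J P S x = P J S x = x = J S x`, and `J` is injective. -/
theorem isInvariant_of_projection (hJ : S.IsResolventAt 0 J) (hJP : J * P = P * J)
    (hPM : ∀ x, P x ∈ M) (hMP : ∀ x ∈ M, P x = x) : S.IsInvariant M := by
  intro x hx
  have h1 : J (S x) = x := by simpa using hJ.2 x
  have h2 : P (S x) = S x := by
    apply hJ.injective
    have : J (P (S x)) = P (J (S x)) := DFunLike.congr_fun hJP (S x)
    rw [this, h1, hMP _ hx]
  rw [← h2]
  exact hPM _

/-- A solution `G` of `G = J (P + z G)` that commutes with `J = S⁻¹` restricts to the resolvent of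
`S|M`, if `P` is a projection onto `M`. -/
theorem isResolventAt_restrictTo (hJ : S.IsResolventAt 0 J) (hJP : J * P = P * J)
    (hPM : ∀ x, P x ∈ M) (hMP : ∀ x ∈ M, P x = x) (hM : S.IsInvariant M) {z : ℂ}
    {G : X →L[ℂ] X} (hG : G = J * (P + z • G)) (hGJ : G * J = J * G) :
    (S.restrictTo M hM).IsResolventAt z
      (((P * G) ∘L M.subtypeL).codRestrict M fun x => hPM (G x)) := by
  have hJ1 : ∀ x, P (J x) = J (P x) := fun x => (DFunLike.congr_fun hJP x).symm
  have hPP : ∀ x, P (P x) = P x := fun x => hMP _ (hPM x)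
  have hG1 : ∀ x, G x = J (P x + z • G x) := fun x => DFunLike.congr_fun hG x
  have hG2 : ∀ x, G (J x) = J (G x) := fun x => DFunLike.congr_fun hGJ x
  constructor
  · intro y
    -- `G` is not assumed to map into `M`; `P G` does, and it satisfies the same equation.
    have h1 : P (G y) = J (y + z • P (G y)) := by
      conv_lhs => rw [hG1]
      rw [hJ1, _root_.map_add, hPP, hMP _ y.2, _root_.map_smul]
    have h2 : P (G y) ∈ S.domain := by
      rw [h1]
      exact hJ.mem_domain _
    have h3 : S ⟨P (G y), h2⟩ = y + z • P (G y) := by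
      have := hJ.map_apply (y + z • P (G y))
      rw [zero_smul, add_zero] at this
      rw [← this]
      congr 2
    refine ⟨h2, Subtype.ext ?_⟩
    show S ⟨P (G y), h2⟩ - z • P (G y) = y
    rw [h3, add_sub_cancel_right]
  · intro x
    refine Subtype.ext ?_
    have hx : ((x : M) : X) ∈ S.domain := x.2
    have hSx : S ⟨x, hx⟩ ∈ M := hM ⟨x, hx⟩ (x : M).2
    have h1 : J (S ⟨x, hx⟩) = x := by simpa using hJ.2 ⟨x, hx⟩
    show P (G (S ⟨x, hx⟩ - z • ((x : M) : X))) = x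
    have h2 : G (S ⟨x, hx⟩ - z • ((x : M) : X)) = x := by
      have h3 := hG1 (S ⟨x, hx⟩)
      rw [hMP _ hSx, _root_.map_add, h1, _root_.map_smul, ← hG2, h1] at h3
      rw [_root_.map_sub, _root_.map_smul, h3, add_sub_cancel_right]
    rw [h2, hMP _ (x : M).2]

variable (hc : Submodule.IsTopCompl M N)

/-- Invariance under `S` alone does not give invariance under `S⁻¹`. Here `S|M` is onto `M`, and
injectivity of `S` identifies the two preimages. -/
theorem mem_of_restrictTo_resolventSet (hJ : S.IsResolventAt 0 J) {hM : S.IsInvariant M}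
    {r : M →L[ℂ] M} (hr : (S.restrictTo M hM).IsResolventAt 0 r) {x : X} (hx : x ∈ M) :
    J x ∈ M := by
  have : J x = r ⟨x, hx⟩ := by
    refine hJ.apply_eq (hr.mem_domain ⟨x, hx⟩) ?_
    exact congrArg Subtype.val (hr.map_apply ⟨x, hx⟩) |>.trans (by simp)
  rw [this]
  exact (r _).2

/-- A bounded operator on `M` extended by zero to the complement `N`. -/
def extendByZero (r : M →L[ℂ] M) : X →L[ℂ] X :=
  M.subtypeL ∘L r ∘L M.projectionOntoL N hc

theorem extendByZero_mul (r r' : M →L[ℂ] M) :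
    extendByZero hc r * extendByZero hc r' = extendByZero hc (r * r') := by
  ext x
  simp [extendByZero]

theorem norm_extendByZero_le (r : M →L[ℂ] M) :
    ‖extendByZero hc r‖ ≤ ‖r‖ * ‖M.projectionOntoL N hc‖ := by
  refine ContinuousLinearMap.opNorm_le_bound _ (by positivity) fun x => ?_
  rw [mul_assoc]
  exact (r.le_opNorm _).trans (by gcongr; exact ContinuousLinearMap.le_opNorm _ _)

theorem extendByZero_eq (hJ : S.IsResolventAt 0 J) {hM : S.IsInvariant M} {z : ℂ}
    {r : M →L[ℂ] M} (hr : (S.restrictTo M hM).IsResolventAt z r) :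
    extendByZero hc r = J * (M.projectionL N hc + z • extendByZero hc r) := by
  ext x
  refine (hJ.apply_eq (hr.mem_domain (M.projectionOntoL N hc x)) ?_).symm
  rw [zero_smul, add_zero]
  exact congrArg Subtype.val (hr.map_apply (M.projectionOntoL N hc x))

theorem mul_projectionL (hJM : ∀ x ∈ M, J x ∈ M) (hJN : ∀ x ∈ N, J x ∈ N) :
    J * M.projectionL N hc = M.projectionL N hc * J := by
  ext x
  have h1 : x - M.projectionL N hc x ∈ N := by
    rw [← Submodule.projectionL_apply_eq_zero_iff hc, _root_.map_sub, sub_eq_zero]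
    exact (Submodule.projectionL_apply_left hc (M.projectionOntoL N hc x)).symm
  have h2 := (Submodule.projectionL_apply_eq_zero_iff hc).2 (hJN _ h1)
  have h3 := Submodule.projectionL_apply_left hc
    ⟨_, hJM _ (Submodule.projectionL_apply_mem hc x)⟩
  rw [_root_.map_sub, _root_.map_sub, sub_eq_zero] at h2
  exact (h2.trans h3).symm

theorem extendByZero_commute (hJ : S.IsResolventAt 0 J) {hM : S.IsInvariant M} {z : ℂ}
    {r : M →L[ℂ] M} (hr : (S.restrictTo M hM).IsResolventAt z r)
    (hJM : ∀ x ∈ M, J x ∈ M) (hJN : ∀ x ∈ N, J x ∈ N) :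
    extendByZero hc r * J = J * extendByZero hc r := by
  ext y
  set p := M.projectionOntoL N hc y with hp
  have h0 : M.projectionOntoL N hc (J y) = ⟨J p, hJM _ p.2⟩ :=
    Subtype.ext (DFunLike.congr_fun (mul_projectionL hc hJM hJN) y).symm
  have h1 : ((r p : M) : X) = J (p + z • (r p : X)) :=
    DFunLike.congr_fun (extendByZero_eq hc hJ hr) y
  have h2 : S ⟨J (r p), hJ.mem_domain _⟩ = r p := by simpa using hJ.map_apply (r p : X)
  have h3 : r ⟨J p, hJM _ p.2⟩ = ⟨J (r p), hJM _ (r p).2⟩ := by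
    refine hr.apply_eq (hJ.mem_domain _) (Subtype.ext ?_)
    show S ⟨J (r p), hJ.mem_domain _⟩ = J p + z • J (r p)
    rw [h2, ← _root_.map_smul, ← _root_.map_add, ← h1]
  show ((r (M.projectionOntoL N hc (J y)) : M) : X) = J (r p)
  rw [h0, h3]

theorem mul_projectionL_eq_extendByZero {R : X →L[ℂ] X} {z : ℂ} (hR : S.IsResolventAt z R)
    {hM : S.IsInvariant M} {r : M →L[ℂ] M} (hr : (S.restrictTo M hM).IsResolventAt z r) :
    R * M.projectionL N hc = extendByZero hc r := by
  ext x
  refine hR.apply_eq (hr.mem_domain (M.projectionOntoL N hc x)) ?_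
  exact congrArg Subtype.val (hr.map_apply (M.projectionOntoL N hc x))

end Restriction

end LinearPMap

/-! ### The projection belonging to a given strict dichotomy. -/

namespace AxisIntegral

theorem IsLeftExtension.of_identity {A : Type*} [NormedRing A] [NormedAlgebra ℂ A] {J P : A}
    {G : ℂ → A} {C : ℝ} (hb : ∀ z : ℂ, z.re ≤ 0 → ‖G z‖ ≤ C)
    (heq : ∀ z : ℂ, z.re ≤ 0 → G z = J * (P + z • G z))
    (hcomm : ∀ z : ℂ, z.re ≤ 0 → G z * J = J * G z)
    (hid : ∀ z w : ℂ, z.re ≤ 0 → w.re ≤ 0 → G z - G w = (z - w) • (G z * G w)) :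
    IsLeftExtension J P G C where
  norm_le := hb
  eq_mul := heq
  comm := hcomm
  continuousOn := continuousOn_const.mul
    (continuousOn_of_resolvent_identity fun z hz w hw => hid z w hz hw)
  differentiableOn := (differentiableOn_of_resolvent_identity (U := {z | z.re < 0})
    (isOpen_lt (by fun_prop) (by fun_prop))
    fun z (hz : z.re < 0) w (hw : w.re < 0) => hid z w hz.le hw.le).const_mul _

end AxisIntegral

namespace LinearPMap

open AxisIntegral AxisIntegral.IsStripFamily

variable {X : Type*} [NormedAddCommGroup X] [NormedSpace ℂ X]

section

variable {S : X →ₗ.[ℂ] X} {M N : Submodule ℂ X} (hc : Submodule.IsTopCompl M N)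

theorem extendByZero_identity {hM : S.IsInvariant M} {z w : ℂ} {r r' : M →L[ℂ] M}
    (hr : (S.restrictTo M hM).IsResolventAt z r) (hr' : (S.restrictTo M hM).IsResolventAt w r') :
    extendByZero hc r - extendByZero hc r' =
      (z - w) • (extendByZero hc r * extendByZero hc r') := by
  rw [extendByZero_mul]
  have h1 : extendByZero hc r - extendByZero hc r' = extendByZero hc (r - r') := by
    ext x
    simp [extendByZero]
  rw [h1, hr.identity hr']
  ext x
  simp [extendByZero]

theorem projectionL_add_projectionL : M.projectionL N hc + N.projectionL M hc.symm = 1 :=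
  Submodule.projectionL_add_projectionL_eq_id hc

/-- On the axis the resolvent is the sum of the resolvents of the two parts, each extended by zero
and bounded in its half-plane. The part on `Xp`, continued to the left, contributes only the pole
shift `J² Pp`; the part on `Xm`, continued to the right together with `(z + 1)⁻¹`, contributes
nothing. So `P` is the projection onto `Xp` along `Xm`. -/
theorem IsStrictlyDichotomousWrt.exists_projection [CompleteSpace X] {Xp Xm : Submodule ℂ X}
    (hd : S.IsStrictlyDichotomousWrt Xp Xm) :
    ∃ (P : X →L[ℂ] X) (C : ℝ), (∀ z : ℂ, z.re = 0 → ‖S.resolventOp z‖ ≤ C) ∧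
      AxisIntegrable (kernel S.resolventOp) ∧
      P * (S.resolventOp 0 * S.resolventOp 0) = axisIntegral (kernel S.resolventOp) := by
  have hc : Submodule.IsTopCompl Xp Xm :=
    Submodule.IsCompl.isTopCompl_of_isClosed hd.isCompl hd.isClosed_plus hd.isClosed_minus
  have hRz : ∀ z : ℂ, z.re = 0 → S.IsResolventAt z (S.resolventOp z) := fun z hz =>
    isResolventAt_resolventOp (hd.imaginary_axis z hz)
  set J := S.resolventOp 0
  have hJ : S.IsResolventAt 0 J := hRz 0 rfl
  set rp := (S.restrictTo Xp hd.invariant_plus).resolventOp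
  set rm := (S.restrictTo Xm hd.invariant_minus).resolventOp
  have hrp : ∀ z : ℂ, z.re ≤ 0 → (S.restrictTo Xp hd.invariant_plus).IsResolventAt z (rp z) :=
    fun z hz => isResolventAt_resolventOp
      (by_contra fun h => absurd (hd.spectrum_plus h) (not_lt.2 hz))
  have hrm : ∀ z : ℂ, 0 ≤ z.re → (S.restrictTo Xm hd.invariant_minus).IsResolventAt z (rm z) :=
    fun z hz => isResolventAt_resolventOp
      (by_contra fun h => absurd (hd.spectrum_minus h) (not_lt.2 hz))
  obtain ⟨Cp, hCp⟩ := hd.bounded_plus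
  obtain ⟨Cm, hCm⟩ := hd.bounded_minus
  have hJp : ∀ x ∈ Xp, J x ∈ Xp := fun x hx =>
    mem_of_restrictTo_resolventSet hJ (hrp 0 le_rfl) hx
  have hJm : ∀ x ∈ Xm, J x ∈ Xm := fun x hx =>
    mem_of_restrictTo_resolventSet hJ (hrm 0 le_rfl) hx
  set Pp := Xp.projectionL Xm hc
  set Pm := Xm.projectionL Xp hc.symm
  have hadd : Pp + Pm = 1 := projectionL_add_projectionL hc
  set Gp : ℂ → X →L[ℂ] X := fun z => extendByZero hc (rp z)
  set Gm : ℂ → X →L[ℂ] X := fun z => extendByZero hc.symm (rm z)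
  have hGp : IsLeftExtension J Pp Gp (Cp * ‖Xp.projectionOntoL Xm hc‖) := by
    refine .of_identity (fun z hz => ?_) (fun z hz => extendByZero_eq hc hJ (hrp z hz))
      (fun z hz => extendByZero_commute hc hJ (hrp z hz) hJp hJm)
      (fun z w hz hw => extendByZero_identity hc (hrp z hz) (hrp w hw))
    refine (norm_extendByZero_le hc _).trans ?_
    gcongr
    exact hCp (mem_image_of_mem _ hz)
  have hpos : ∀ {z : ℂ}, z.re ≤ 0 → 0 ≤ (-z).re := fun hz => by simpa using hz
  have hGm : IsLeftExtension (-J) Pm (fun z => -Gm (-z))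
      (Cm * ‖Xm.projectionOntoL Xp hc.symm‖) := by
    refine .of_identity (fun z hz => ?_) (fun z hz => ?_) (fun z hz => ?_) (fun z w hz hw => ?_)
    · rw [norm_neg]
      refine (norm_extendByZero_le hc.symm _).trans ?_
      gcongr
      exact hCm (mem_image_of_mem _ (hpos hz))
    · have := extendByZero_eq hc.symm hJ (hrm _ (hpos hz))
      rw [neg_mul, smul_neg, ← neg_smul]
      exact congrArg Neg.neg this
    · have := extendByZero_commute hc.symm hJ (hrm _ (hpos hz)) hJm hJp
      rw [neg_mul_neg, neg_mul_neg]
      exact this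
    · have := extendByZero_identity hc.symm (hrm _ (hpos hz)) (hrm _ (hpos hw))
      rw [neg_mul_neg, ← neg_sub', this, ← neg_smul]
      congr 1
      ring
  have hsum : ∀ z : ℂ, z.re = 0 → S.resolventOp z = Gp z + Gm z := by
    intro z hz
    show _ = extendByZero hc (rp z) + extendByZero hc.symm (rm z)
    rw [← mul_projectionL_eq_extendByZero hc (hRz z hz) (hrp z hz.le),
      ← mul_projectionL_eq_extendByZero hc.symm (hRz z hz) (hrm z hz.ge), ← mul_add, hadd, mul_one]
  -- The second summand is the left extension for `-S` evaluated at `-z`: its reference pole `1`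
  -- becomes the pole `-1` of the kernel, so no shift is needed.
  have hker : ∀ z : ℂ, z.re = 0 → (J * J * Gp z + (z + 1)⁻¹ • (J * J * Pp)) +
      -(-J * -J * -Gm (- -z) + (-z - 1)⁻¹ • (-J * -J * Pm)) = kernel S.resolventOp z := by
    intro z hz
    have c1 : Commute (Gp z) J := extendByZero_commute hc hJ (hrp z hz.le) hJp hJm
    have c2 : Commute (Gm z) J := extendByZero_commute hc.symm hJ (hrm z hz.ge) hJm hJp
    have e1 : (-z - 1 : ℂ)⁻¹ = -(z + 1)⁻¹ := by rw [← inv_neg]; congr 1; ring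
    have e2 : (z + 1)⁻¹ • (J * J) = (z + 1)⁻¹ • (J * J * Pp) + (z + 1)⁻¹ • (J * J * Pm) := by
      rw [← smul_add, ← mul_add, hadd, mul_one]
    rw [kernel, hsum z hz, add_mul, (c1.mul_right c1).eq, (c2.mul_right c2).eq, e1, e2, neg_neg,
      neg_mul_neg, mul_neg, neg_smul]
    abel
  have hi1 := hGp.axisIntegrable.add_inv_add_one_smul
  have hi2 : AxisIntegrable fun z => -(-J * -J * -Gm (- -z) + (-z - 1)⁻¹ • (-J * -J * Pm)) :=
    hGm.axisIntegrable.comp_neg.neg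
  refine ⟨Pp, Cp * ‖Xp.projectionOntoL Xm hc‖ + Cm * ‖Xm.projectionOntoL Xp hc.symm‖,
    fun z hz => ?_, ?_, ?_⟩
  · rw [hsum z hz]
    refine (norm_add_le _ _).trans (add_le_add (hGp.norm_le z hz.le) ?_)
    simpa using hGm.norm_le (-z) (by simp [hz])
  · exact (hi1.add hi2).congr hker
  · have hPJ : Commute Pp J := (mul_projectionL hc hJp hJm).symm
    have hz2 := hGm.axisIntegral_eq_zero
    rw [← axisIntegral_comp_neg] at hz2
    rw [← axisIntegral_congr hker, axisIntegral_add hi1 hi2,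
      axisIntegral_add_inv_add_one_smul hGp.axisIntegrable, hGp.axisIntegral_eq_zero,
      axisIntegral_neg, hz2, neg_zero, add_zero, zero_add, (hPJ.mul_right hPJ).eq]

end

end LinearPMap

/-! ### Uniform bounds on a strip and integrability of the resolvent difference. -/

namespace AxisIntegral

variable {X : Type*} [NormedAddCommGroup X] [NormedSpace ℂ X]

/-- A resolvent family that is bounded on the imaginary axis is bounded on a strip. -/
theorem exists_strip_bound {R : ℂ → X →L[ℂ] X} {h N : ℝ} (hh : 0 < h)
    (hid : ∀ z w : ℂ, |z.re| ≤ h → |w.re| ≤ h → R z - R w = (z - w) • (R z * R w))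
    (hN : ∀ z : ℂ, z.re = 0 → ‖R z‖ ≤ N) :
    ∃ a : ℝ, 0 < a ∧ a ≤ h ∧ ∀ z : ℂ, |z.re| ≤ a → ‖R z‖ ≤ 2 * N := by
  have hN0 : 0 ≤ N := (norm_nonneg _).trans (hN 0 rfl)
  -- The width makes `|Re z| N ≤ 1/2`, so comparison with `w = i Im z` gives `‖R z‖ ≤ ‖R z‖ / 2 +
  -- N`; `N + 1` covers `N = 0`.
  refine ⟨min h (2 * (N + 1))⁻¹, lt_min hh (by positivity), min_le_left _ _, fun z hz => ?_⟩
  have hz1 : |z.re| ≤ h := hz.trans (min_le_left _ _)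
  have hz2 : |z.re| ≤ (2 * (N + 1))⁻¹ := hz.trans (min_le_right _ _)
  set w : ℂ := z.im * I with hw
  have hw0 : w.re = 0 := by simp [hw]
  have hzw : z - w = z.re := by
    rw [hw, sub_eq_iff_eq_add]
    exact (re_add_im z).symm
  have h1 := hid z w hz1 (by simpa [hw0] using hh.le)
  have h2 : ‖R z - R w‖ ≤ |z.re| * (‖R z‖ * ‖R w‖) := by
    rw [h1, norm_smul, hzw, norm_real, Real.norm_eq_abs]
    gcongr
    exact norm_mul_le _ _
  have h3 : |z.re| * N ≤ 1 / 2 := by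
    calc |z.re| * N ≤ (2 * (N + 1))⁻¹ * N := by gcongr
      _ ≤ 1 / 2 := by
        rw [inv_mul_le_iff₀ (by positivity)]
        linarith
  have h4 : ‖R z‖ ≤ ‖R z - R w‖ + ‖R w‖ := by simpa using norm_add_le (R z - R w) (R w)
  have h5 : |z.re| * (‖R z‖ * ‖R w‖) ≤ |z.re| * (‖R z‖ * N) := by
    gcongr
    exact hN w hw0
  nlinarith [norm_nonneg (R z), hN w hw0]

theorem isCompact_axis_segment : IsCompact {z : ℂ | z.re = 0 ∧ ‖z‖ ≤ 1} := by
  refine (isCompact_closedBall (0 : ℂ) 1).of_isClosed_subset ?_ fun z hz => by simpa using hz.2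
  exact (isClosed_eq continuous_re continuous_const).inter
    (isClosed_le continuous_norm continuous_const)

theorem axisIntegrable_of_rpow_decay {E : Type*} [NormedAddCommGroup E] {f : ℂ → E} {ε C N : ℝ}
    (hε : 0 < ε) (hc : ContinuousOn f {z | z.re = 0})
    (hC : ∀ z : ℂ, z.re = 0 → ‖z‖ ^ (1 + ε) * ‖f z‖ ≤ C)
    (hN : ∀ z : ℂ, z.re = 0 → ‖f z‖ ≤ N) : AxisIntegrable f := by
  have hcont : Continuous fun t : ℝ => f (t * I) :=
    hc.comp_continuous (by fun_prop) fun t => re_ofReal_mul_I t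
  have hN0 : 0 ≤ N := (norm_nonneg _).trans (hN 0 rfl)
  have hC0 : 0 ≤ C := (by positivity : (0 : ℝ) ≤ ‖(0 : ℂ)‖ ^ (1 + ε) * ‖f 0‖).trans (hC 0 rfl)
  have hint : Integrable fun t : ℝ => (1 + ‖t‖) ^ (-(1 + ε)) :=
    integrable_one_add_norm (by simpa using hε)
  -- The weighted bound is void at `0`, so `N` serves for `|t| ≤ 1`; for `|t| ≥ 1`, `1 + |t| ≤ 2
  -- |t|` accounts for the factor `2 ^ (1 + ε)`.
  refine Integrable.mono' (hint.const_mul (2 ^ (1 + ε) * (C + N)))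
    hcont.aestronglyMeasurable (Eventually.of_forall fun t => ?_)
  have h1 := hC (t * I) (re_ofReal_mul_I t)
  have h2 := hN (t * I) (re_ofReal_mul_I t)
  rw [norm_ofReal_mul_I] at h1
  rw [Real.norm_eq_abs, Real.rpow_neg (by positivity), ← div_eq_mul_inv,
    le_div_iff₀ (by positivity)]
  rcases le_total |t| 1 with ht | ht
  · have h3 : (1 + |t|) ^ (1 + ε) ≤ 2 ^ (1 + ε) := by
      gcongr
      linarith
    calc ‖f (t * I)‖ * (1 + |t|) ^ (1 + ε) ≤ N * 2 ^ (1 + ε) := by gcongr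
      _ ≤ 2 ^ (1 + ε) * (C + N) := by
        rw [mul_comm]
        gcongr
        linarith
  · have h3 : (1 + |t|) ^ (1 + ε) ≤ 2 ^ (1 + ε) * |t| ^ (1 + ε) := by
      rw [← Real.mul_rpow (by norm_num) (abs_nonneg t)]
      gcongr
      linarith
    calc ‖f (t * I)‖ * (1 + |t|) ^ (1 + ε)
        ≤ ‖f (t * I)‖ * (2 ^ (1 + ε) * |t| ^ (1 + ε)) := by gcongr
      _ = 2 ^ (1 + ε) * (|t| ^ (1 + ε) * ‖f (t * I)‖) := by ring
      _ ≤ 2 ^ (1 + ε) * (C + N) := by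
        gcongr
        linarith

end AxisIntegral

/-! ### Construction of the dichotomy from the projection. -/

namespace LinearPMap

open AxisIntegral AxisIntegral.IsStripFamily

variable {X : Type*} [NormedAddCommGroup X] [NormedSpace ℂ X]

theorem dense_domainSq_denseRange {T : X →ₗ.[ℂ] X} {J : X →L[ℂ] X} (hJ : T.IsResolventAt 0 J)
    (hT : Dense T.domainSq) : DenseRange (J * J) :=
  hT.mono fun _ hx => hJ.exists_eq_of_mem_domainSq hx

variable [CompleteSpace X]

/-- A bounded operator that is given by the regularised resolvent integral is the projection of a
strict dichotomy. -/
theorem isStrictlyDichotomous_of_projection {T : X →ₗ.[ℂ] X} {h M : ℝ} {P : X →L[ℂ] X}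
    (hax : ∀ z : ℂ, z.re = 0 → z ∈ T.resolventSet)
    (hR : IsStripFamily T.resolventOp h M)
    (hP : P * (T.resolventOp 0 * T.resolventOp 0) = axisIntegral (kernel T.resolventOp)) :
    T.IsStrictlyDichotomous := by
  have hJ : T.IsResolventAt 0 (T.resolventOp 0) := isResolventAt_resolventOp (hax 0 rfl)
  have hPP : IsIdempotentElem P := hR.isIdempotentElem hP
  have hJP := hR.projection_commute hP hR.mem_zero
  obtain ⟨Gp, Cp, hGp, -⟩ := hR.exists_isLeftExtension hP
  -- `Gm` belongs to `-T` and `1 - P`, so `z ↦ -Gm (-z)` continues `R z * (1 - P)` to the right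
  -- half-plane.
  obtain ⟨Gm, Cm, hGm, -⟩ := hR.reflect.exists_isLeftExtension (hR.kernel_reflect hP)
  set J := T.resolventOp 0 with hJdef
  simp only [neg_zero, ← hJdef] at hGm
  have hc : Submodule.IsTopCompl P.range P.ker :=
    ContinuousLinearMap.IsIdempotentElem.isTopCompl hPP
  have hPp1 : ∀ x, P x ∈ P.range := fun x => ⟨x, rfl⟩
  have hPp2 : ∀ x ∈ P.range, P x = x := by
    rintro _ ⟨x, rfl⟩
    exact DFunLike.congr_fun hPP x
  have hPm1 : ∀ x, (1 - P) x ∈ P.ker := by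
    intro x
    show P (x - P x) = 0
    rw [_root_.map_sub, sub_eq_zero]
    exact (DFunLike.congr_fun hPP x).symm
  have hPm2 : ∀ x ∈ P.ker, (1 - P) x = x := by
    intro x (hx : P x = 0)
    show x - P x = x
    rw [hx, sub_zero]
  have hJQ : J * (1 - P) = (1 - P) * J := by rw [mul_sub, sub_mul, mul_one, one_mul, hJP]
  have hIp := isInvariant_of_projection hJ hJP hPp1 hPp2
  have hIm := isInvariant_of_projection hJ hJQ hPm1 hPm2
  have hrp : ∀ z : ℂ, z.re ≤ 0 → (T.restrictTo P.range hIp).IsResolventAt z _ := fun z hz =>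
    isResolventAt_restrictTo hJ hJP hPp1 hPp2 hIp (hGp.eq_mul z hz) (hGp.comm z hz)
  have hneg : ∀ {z : ℂ}, 0 ≤ z.re → (-z).re ≤ 0 := fun hz => by simpa using hz
  have hGm1 : ∀ z : ℂ, 0 ≤ z.re → -Gm (-z) = J * ((1 - P) + z • -Gm (-z)) := by
    intro z hz
    have := hGm.eq_mul (-z) (hneg hz)
    rw [neg_mul, neg_smul, ← smul_neg] at this
    exact neg_eq_iff_eq_neg.2 this
  have hGm2 : ∀ z : ℂ, 0 ≤ z.re → -Gm (-z) * J = J * -Gm (-z) := by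
    intro z hz
    have := hGm.comm (-z) (hneg hz)
    rwa [mul_neg, neg_mul, ← neg_mul, ← mul_neg] at this
  have hrm : ∀ z : ℂ, 0 ≤ z.re → (T.restrictTo P.ker hIm).IsResolventAt z _ := fun z hz =>
    isResolventAt_restrictTo hJ hJQ hPm1 hPm2 hIm (hGm1 z hz) (hGm2 z hz)
  refine ⟨P.range, P.ker, ⟨⟨hc.isClosed, hc.isClosed', hc.isCompl, hax, hIp, hIm,
    fun z hz => ?_, fun z hz => ?_⟩, ?_, ?_⟩⟩
  · by_contra hz'
    exact hz ⟨_, hrp z (not_lt.1 hz')⟩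
  · by_contra hz'
    exact hz ⟨_, hrm z (not_lt.1 hz')⟩
  · refine ⟨‖P‖ * Cp, ?_⟩
    rintro _ ⟨z, hz, rfl⟩
    have hCp : 0 ≤ Cp := (norm_nonneg _).trans (hGp.norm_le z hz)
    simp only [(hrp z hz).resolventOp_eq]
    refine ContinuousLinearMap.opNorm_le_bound _ (by positivity) fun x => ?_
    refine ((P * Gp z).le_opNorm x).trans ?_
    gcongr
    · exact (norm_mul_le _ _).trans (by gcongr; exact hGp.norm_le z hz)
    · exact le_rfl
  · refine ⟨‖1 - P‖ * Cm, ?_⟩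
    rintro _ ⟨z, hz, rfl⟩
    have hle : ‖-Gm (-z)‖ ≤ Cm := by
      rw [norm_neg]
      exact hGm.norm_le (-z) (hneg hz)
    have hCm : 0 ≤ Cm := (norm_nonneg _).trans hle
    simp only [(hrm z hz).resolventOp_eq]
    refine ContinuousLinearMap.opNorm_le_bound _ (by positivity) fun x => ?_
    refine (((1 - P) * -Gm (-z)).le_opNorm x).trans ?_
    gcongr
    · exact (norm_mul_le _ _).trans (by gcongr)
    · exact le_rfl

end LinearPMap

/-! ### The perturbation theorem. -/

open AxisIntegral AxisIntegral.IsStripFamily LinearPMap in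
theorem theorem7p1 {X : Type*} [NormedAddCommGroup X] [NormedSpace ℂ X] [CompleteSpace X]
    (S T : X →ₗ.[ℂ] X)
    (hS : Dense (S.domain : Set X)) (hSd : S.IsStrictlyDichotomous)
    (hT : Dense (T.domain : Set X))
    (h ε : ℝ) (hh : 0 < h) (hε : 0 < ε)
    (hstrip : {z : ℂ | |z.re| ≤ h} ⊆ S.resolventSet ∩ T.resolventSet)
    (hbound : BddAbove ((fun z : ℂ => ‖z‖ ^ (1 + ε) * ‖S.resolventOp z - T.resolventOp z‖) ''
      {z : ℂ | |z.re| ≤ h}))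
    (hdense : Dense (S.domainSq ∩ T.domainSq)) :
    T.IsStrictlyDichotomous := by
  obtain ⟨Xp, Xm, hd⟩ := hSd
  obtain ⟨PS, NS, hNS, hkS, hPS⟩ := hd.exists_projection
  obtain ⟨C, hC⟩ := hbound
  have haxis : ∀ z : ℂ, z.re = 0 → |z.re| ≤ h := fun z hz => by simpa [hz] using hh.le
  have hSres : ∀ z : ℂ, |z.re| ≤ h → S.IsResolventAt z (S.resolventOp z) := fun z hz =>
    isResolventAt_resolventOp (hstrip hz).1
  have hTres : ∀ z : ℂ, |z.re| ≤ h → T.IsResolventAt z (T.resolventOp z) := fun z hz =>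
    isResolventAt_resolventOp (hstrip hz).2
  have hidT : ∀ z w : ℂ, |z.re| ≤ h → |w.re| ≤ h → T.resolventOp z - T.resolventOp w =
      (z - w) • (T.resolventOp z * T.resolventOp w) := fun z w hz hw =>
    (hTres z hz).identity (hTres w hw)
  have hcS : ContinuousOn S.resolventOp {z | z.re = 0} :=
    continuousOn_of_resolvent_identity fun z hz w hw =>
      (hSres z (haxis z hz)).identity (hSres w (haxis w hw))
  have hcT : ContinuousOn T.resolventOp {z | z.re = 0} :=
    continuousOn_of_resolvent_identity fun z hz w hw => hidT z w (haxis z hz) (haxis w hw)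
  have hCz : ∀ z : ℂ, z.re = 0 → ‖z‖ ^ (1 + ε) * ‖S.resolventOp z - T.resolventOp z‖ ≤ C :=
    fun z hz => hC ⟨z, haxis z hz, rfl⟩
  -- For `‖z‖ ≥ 1` the weight is at least `1`, so `R_T` differs from the bounded `R_S` by at most
  -- `C`; the rest of the axis is compact.
  obtain ⟨NT, hNT⟩ : ∃ N, ∀ z : ℂ, z.re = 0 → ‖T.resolventOp z‖ ≤ N := by
    obtain ⟨K, hK⟩ := isCompact_axis_segment.exists_bound_of_continuousOn
      (hcT.mono fun z hz => hz.1)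
    refine ⟨max K (NS + C), fun z hz => ?_⟩
    rcases le_total ‖z‖ 1 with hz1 | hz1
    · exact (hK z ⟨hz, hz1⟩).trans (le_max_left _ _)
    · refine le_trans ?_ (le_max_right _ _)
      have h1 : ‖S.resolventOp z - T.resolventOp z‖ ≤ C :=
        (le_mul_of_one_le_left (norm_nonneg _)
          (Real.one_le_rpow hz1 (by linarith))).trans (hCz z hz)
      have h2 := norm_sub_le (S.resolventOp z) (S.resolventOp z - T.resolventOp z)
      rw [sub_sub_cancel] at h2
      linarith [hNS z hz]
  obtain ⟨a, ha, hah, hbd⟩ := exists_strip_bound hh hidT hNT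
  have hJT := hTres 0 (haxis 0 rfl)
  have hJS := hSres 0 (haxis 0 rfl)
  have hR : IsStripFamily T.resolventOp a (2 * NT) :=
    ⟨ha, hbd, fun z w hz hw => hidT z w (hz.trans hah) (hw.trans hah), hJT.injective,
      dense_domainSq_denseRange hJT (hdense.mono inter_subset_right)⟩
  have hD : AxisIntegrable fun z => T.resolventOp z - S.resolventOp z := by
    refine axisIntegrable_of_rpow_decay (N := NT + NS) hε (hcT.sub hcS) (C := C)
      (fun z hz => ?_) fun z hz => ?_
    · rw [norm_sub_rev]
      exact hCz z hz
    · exact (norm_sub_le _ _).trans (add_le_add (hNT z hz) (hNS z hz))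
  set P : X →L[ℂ] X := PS + axisIntegral fun z => T.resolventOp z - S.resolventOp z with hPdef
  have happly : ∀ {f : ℂ → X →L[ℂ] X} (_ : AxisIntegrable f) (v : X),
      axisIntegral f v = axisIntegral fun z => f z v := fun hf v =>
    clm_axisIntegral (ContinuousLinearMap.apply ℂ X v) hf
  have hJA := hR.integral_kernel_commute hR.mem_zero
  set J := T.resolventOp 0 with hJ
  -- `P J² = A` cannot be checked directly, as the range of `J²` need not lie in `D(S²)`. On `x =
  -- J_S² u = J² v` the regularising terms of both kernels are `(z + 1)⁻¹ x` and cancel, so `P x = A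
  -- v` and `J² P x = A x`; such `x` are dense.
  have hA : J * J * P = axisIntegral (kernel T.resolventOp) := by
    refine ContinuousLinearMap.coeFn_injective (Continuous.ext_on hdense
      (J * J * P).continuous (axisIntegral (kernel T.resolventOp)).continuous ?_)
    rintro x ⟨hxS, hxT⟩
    obtain ⟨u, hu⟩ := hJS.exists_eq_of_mem_domainSq hxS
    obtain ⟨v, hv⟩ := hJT.exists_eq_of_mem_domainSq hxT
    have h1 : PS x = axisIntegral fun z => kernel S.resolventOp z u := by
      rw [← happly hkS, ← hPS, ← hu]
      rfl
    have h2 : P x = axisIntegral (kernel T.resolventOp) v := by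
      show PS x + (axisIntegral fun z => T.resolventOp z - S.resolventOp z) x = _
      rw [h1, happly hD, happly hR.kernel_axisIntegrable]
      refine (axisIntegral_add (hkS.clm_apply (ContinuousLinearMap.apply ℂ X u))
        (hD.clm_apply (ContinuousLinearMap.apply ℂ X x))).symm.trans ?_
      refine axisIntegral_congr fun z _ => ?_
      show (S.resolventOp z ((S.resolventOp 0 * S.resolventOp 0) u) +
        (z + 1)⁻¹ • ((S.resolventOp 0 * S.resolventOp 0) u)) +
        (T.resolventOp z x - S.resolventOp z x) =
        T.resolventOp z ((J * J) v) + (z + 1)⁻¹ • ((J * J) v)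
      rw [hu, hv]
      abel
    show J (J (P x)) = _
    have h3 : ∀ y, J (axisIntegral (kernel T.resolventOp) y) =
        axisIntegral (kernel T.resolventOp) (J y) := fun y => DFunLike.congr_fun hJA y
    rw [h2, h3, h3, ← hv]
    rfl
  refine isStrictlyDichotomous_of_projection (fun z hz => (hstrip (haxis z hz)).2) hR (P := P) ?_
  -- `J² P J² = A J² = J² A`, and the injective `J²` cancels on the left.
  refine hR.cancel_left (hR.cancel_left ?_)
  have hc : Commute J (axisIntegral (kernel T.resolventOp)) := hJA
  rw [← hJ, ← mul_assoc, ← mul_assoc, ← mul_assoc, hA, ← mul_assoc, mul_assoc _ J J]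
  exact ((hc.mul_left hc).eq).symm
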